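/- Let $\mathrm{Homeo}^+(S^1)$ be the group of orientation-preserving homeomorphisms of the circle. A lamination of $S^1$ is a closed subset $\Lambda$ of the space of unordered pairs of distinct points of $S^1$ whose elements (the leaves) are pairwise unlinked, where $\{a,b\}$ and $\{c,d\}$ are linked if each component of $S^1\setminus\{a,b\}$ contains exactly one of $c,d$. Joining the endpoints of each leaf by a chord of the unit disk, a gap of $\Lambda$ is the closure of a connected component of the complement of these chords in the open disk. The lamination $\Lambda$ is dense if the endpoints of its leaves are dense in $S^1$; it is very full if each gap is a finite-sided ideal polygon (the convex hull of finitely many, at least three, points of $S^1$); and it is loose if no two distinct leaves share an endpoint unless they are edges of the same gap. A group $G$ is pseudo-fibered if it is a finitely generated discrete subgroup of $\mathrm{Homeo}^+(S^1)$ that admits a dense $G$-invariant lamination, it admits a pair of very full, loose, $G$-invariant laminations $\Lambda_1,\Lambda_2$ such that no point is an endpoint both of a leaf of $\Lambda_1$ and of a leaf of $\Lambda_2$, and each nontrivial element of $G$ has at most countably many fixed points in $S^1$. For $f\in\mathrm{Homeo}^+(S^1)$ let $\mathrm{Per}_f$ be the set of points of $S^1$ whose orbit under $f$ is finite. **Theorem.**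 Let $G$ be a torsion-free pseudo-fibered group, and let $g,h\in G$ be nontrivial elements. Then $\mathrm{Per}_g$ and $\mathrm{Per}_h$ are either equal or disjoint. -/

import Mathlib

namespace CircleLamination

/-- The circle `S¹ = ℝ/ℤ`, with its usual topology and cyclic order. -/
abbrev S1 : Type := AddCircle (1 : ℝ)

/-- The point of the unit circle of `ℂ` that corresponds to a point of `S¹`. -/
noncomputable def toPlane (x : S1) : ℂ := (AddCircle.toCircle x : ℂ)

/-- `Homeo⁺(S¹)`: the homeomorphisms of the circle that preserve the cyclic order. -/
def HomeoPlus : Subgroup (S1 ≃ₜ S1) where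
  carrier := {f | ∀ a b c : S1, sbtw (f a) (f b) (f c) ↔ sbtw a b c}
  one_mem' := fun _ _ _ => Iff.rfl
  mul_mem' := fun {f g} hf hg a b c => (hf (g a) (g b) (g c)).trans (hg a b c)
  inv_mem' := fun {f} hf a b c => by
    have h := hf (f⁻¹ a) (f⁻¹ b) (f⁻¹ c)
    have e : ∀ x : S1, f (f⁻¹ x) = x := fun x => f.apply_symm_apply x
    rw [e, e, e] at h
    exact h.symm

/-- The pairs `(a, b)` and `(c, d)` are linked: each of the two components (open arcs) of
`S¹ ∖ {a, b}` contains exactly one of `c`, `d`. -/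
def Linked (a b c d : S1) : Prop :=
  (c ∈ Set.cIoo a b ∧ d ∈ Set.cIoo b a) ∨ (c ∈ Set.cIoo b a ∧ d ∈ Set.cIoo a b)

/-- A lamination of `S¹`: a closed set of pairwise unlinked unordered pairs of distinct points.
A set of unordered pairs of distinct points is given as a symmetric set of ordered pairs that
misses the diagonal; closedness is relative to the space of pairs of distinct points. -/
structure Lamination where
  /-- The set of leaves. -/
  leaves : Set (S1 × S1)
  ne : ∀ a b, (a, b) ∈ leaves → a ≠ b
  symm : ∀ a b, (a, b) ∈ leaves → (b, a) ∈ leaves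
  closed : IsClosed ((fun z : {z : S1 × S1 // z.1 ≠ z.2} => (z : S1 × S1)) ⁻¹' leaves)
  unlinked : ∀ a b c d, (a, b) ∈ leaves → (c, d) ∈ leaves → ¬ Linked a b c d

namespace Lamination

variable (L : Lamination)

/-- The set of endpoints of leaves. -/
def Ends : Set S1 := {a | ∃ b, (a, b) ∈ L.leaves}

/-- A lamination is dense if its endpoints are dense in the circle. -/
def IsDense : Prop := Dense L.Ends

/-- Invariance under a group of homeomorphisms of the circle. -/
def IsInvariant (G : Subgroup (S1 ≃ₜ S1)) : Prop :=
  ∀ g ∈ G, ∀ a b : S1, (g a, g b) ∈ L.leaves ↔ (a, b) ∈ L.leaves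

end Lamination

/-- The chord of the unit disk with endpoints `a` and `b`. -/
def chord (a b : S1) : Set ℂ := segment ℝ (toPlane a) (toPlane b)

namespace Lamination

variable (L : Lamination)

/-- The union of the chords in the disk that join the endpoints of the leaves. -/
def support : Set ℂ := {w | ∃ a b : S1, (a, b) ∈ L.leaves ∧ w ∈ chord a b}

/-- A gap: the closure of a connected component of the complement of the leaves in the
(open) unit disk. -/
def IsGap (P : Set ℂ) : Prop :=
  ∃ z ∈ Metric.ball (0 : ℂ) 1 \ L.support,
    P = closure (connectedComponentIn (Metric.ball (0 : ℂ) 1 \ L.support) z)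

/-- The leaf `(a, b)` is an edge of the gap `P` (a leaf never meets the interior of a gap, so that
it lies in the gap exactly when it is a boundary leaf of it). -/
def IsEdgeOf (a b : S1) (P : Set ℂ) : Prop :=
  (a, b) ∈ L.leaves ∧ L.IsGap P ∧ chord a b ⊆ P

end Lamination

/-- A finite-sided ideal polygon in the disk: the convex hull of finitely many (at least three)
points of the circle. -/
def IsIdealPolygon (P : Set ℂ) : Prop :=
  ∃ V : Finset S1, 3 ≤ V.card ∧ P = convexHull ℝ (toPlane '' (V : Set S1))

namespace Lamination

variable (L : Lamination)

/-- Very full: each gap is a finite-sided ideal polygon. -/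
def IsVeryFull : Prop := ∀ P : Set ℂ, L.IsGap P → IsIdealPolygon P

/-- Loose: two distinct leaves share an endpoint only if they are edges of a common gap. -/
def IsLoose : Prop :=
  ∀ p a b : S1, (p, a) ∈ L.leaves → (p, b) ∈ L.leaves → a ≠ b →
    ∃ P : Set ℂ, L.IsEdgeOf p a P ∧ L.IsEdgeOf p b P

end Lamination

/-- `Fix_f`, the set of fixed points. -/
def Fix (f : S1 ≃ₜ S1) : Set S1 := {p | f p = p}

/-- `Per_f`, the set of periodic points: the points whose orbit under `f` is finite. -/
def Per (f : S1 ≃ₜ S1) : Set S1 := {p | (Set.range fun n : ℤ => (f ^ n) p).Finite}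

/-- A subgroup of `Homeo⁺(S¹)` is discrete if it is a discrete set for the
compact-open topology. -/
def IsDiscreteGroup (G : Subgroup (S1 ≃ₜ S1)) : Prop :=
  IsDiscrete ((fun f : S1 ≃ₜ S1 => (f : C(S1, S1))) '' (G : Set (S1 ≃ₜ S1)))

/-- A laminar group: a discrete subgroup of `Homeo⁺(S¹)` with a dense invariant lamination. -/
def IsLaminarGroup (G : Subgroup (S1 ≃ₜ S1)) : Prop :=
  G ≤ HomeoPlus ∧ IsDiscreteGroup G ∧ ∃ L : Lamination, L.IsDense ∧ L.IsInvariant G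

/-- A pseudo-fibered group: a finitely generated laminar group with a pair of very full, loose,
invariant laminations with distinct endpoints, whose nontrivial elements have at most countably
many fixed points each. -/
def IsPseudoFibered (G : Subgroup (S1 ≃ₜ S1)) : Prop :=
  G.FG ∧ IsLaminarGroup G ∧
  (∃ L₁ L₂ : Lamination,
    L₁.IsVeryFull ∧ L₁.IsLoose ∧ L₁.IsInvariant G ∧
    L₂.IsVeryFull ∧ L₂.IsLoose ∧ L₂.IsInvariant G ∧
    Disjoint L₁.Ends L₂.Ends) ∧
  ∀ g ∈ G, g ≠ 1 → (Fix g).Countable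

/-- Torsion-free: no nontrivial element has finite order. -/
def IsTorsionFreeGroup (G : Subgroup (S1 ≃ₜ S1)) : Prop :=
  ∀ g ∈ G, g ≠ 1 → ¬ IsOfFinOrder g

end CircleLamination

/-!
If `Per g` and `Per h` meet in a point `p`, then powers of `g` and `h` fix `p`. They are nontrivial
because the group is torsion-free, and the periodic points of a homeomorphism in `Homeo⁺(S¹)` are
the fixed points of any of its powers that has a fixed point. So it suffices that all nontrivial
elements of the stabilizer of `p` have the same fixed points. Everything is lifted to `ℝ`:
elements of the stabilizer become increasing homeomorphisms fixing a lift of `p`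
(`exists_isLift`), and leaves become a relation `Lamination.Rel` between real numbers.

*Geometry of one lamination.* A gap lies on one side of every leaf, and a supporting chord between
two of its ideal points is a leaf (`mem_leaves_of_supporting`). Hence, for a very full loose
lamination, a point that is not an endpoint is surrounded by arbitrarily short leaves
(`IsVeryFull.exists_short_leaf`), at most two leaves share an endpoint (`IsLoose.not_three`), and a
chain of leaves that does not close up around the circle is finite (`not_chain`), since its points
are vertices of a single gap.

*Dynamics of one element.* Every fixed point `x` fails to be an endpoint for one of the two
laminations. Short leaves around it show that if `x` is isolated from one side, it is isolated from
the other and attracts or repels on both, and that its two neighbouring fixed points are then joined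
by a leaf (`Preserves.rel_of_consecutive`). The set of fixed points is countable and so has an
isolated point; running through the successive fixed points from there, every second one of them
is a vertex of a chain of leaves, so there are finitely many in a period
(`rightIsolated_of_fixed`).

*Dynamics of the stabilizer.* It follows that there is an interval `(p, q)` in which every nontrivial
element of the stabilizer has exactly one fixed point, attracting or repelling
(`exists_forall_hasUniqueCrossing`). Ordering the elements by their behaviour near `p` makes such a
group an Archimedean bi-ordered group, which is commutative by Hölder's theorem
(`commute_of_hasUniqueCrossing`). Commuting elements permute each other's fixed points, which are
isolated, and therefore fix them (`fixed_of_commute`).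
-/

namespace CircleLamination

open Set Filter Topology

/-! ### The circular order of the circle in real coordinates -/

lemma exists_rep (p : ℝ) (x : S1) : ∃ t : ℝ, p ≤ t ∧ t < p + 1 ∧ (t : S1) = x := by
  have h : x ∈ ((↑) : ℝ → S1) '' Ico p (p + 1) := by
    rw [AddCircle.coe_image_Ico_eq]; trivial
  obtain ⟨t, ht, rfl⟩ := h
  exact ⟨t, ht.1, ht.2, rfl⟩

lemma coe_inj_of_near {s t : ℝ} (h1 : s < t + 1) (h2 : t < s + 1) (h : (s : S1) = t) : s = t := by
  rcases le_total s t with hst | hst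
  · exact (AddCircle.coe_eq_coe_iff_of_mem_Ico (p := (1 : ℝ)) (a := s)
      ⟨le_rfl, by linarith⟩ ⟨hst, h2⟩).1 h
  · exact (AddCircle.coe_eq_coe_iff_of_mem_Ico (p := (1 : ℝ)) (a := t)
      ⟨hst, h1⟩ ⟨le_rfl, by linarith⟩).1 h

lemma coe_add_one (s : ℝ) : ((s + 1 : ℝ) : S1) = s := AddCircle.coe_add_period 1 s

lemma sbtw_coe_iff {p s t : ℝ} (hs : p ≤ s) (hs' : s < p + 1) (ht : p ≤ t) (ht' : t < p + 1) :
    sbtw (p : S1) s t ↔ p < s ∧ s < t := by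
  rw [sbtw_iff_not_btw, btw_cyclic]
  have h2 : Btw.btw (p : S1) t s ↔ _ := QuotientAddGroup.btw_coe_iff (p := (1 : ℝ))
  rw [h2]
  have e1 : toIcoMod (zero_lt_one' ℝ) p t = t :=
    (toIcoMod_eq_self _).2 ⟨ht, ht'⟩
  rw [e1]
  rcases eq_or_lt_of_le hs with rfl | hs1
  · have : toIocMod (zero_lt_one' ℝ) p p = p + 1 := by simp
    rw [this]
    constructor
    · intro h; exact absurd ht'.le h
    · rintro ⟨h, _⟩; exact absurd h (lt_irrefl _)
  · have : toIocMod (zero_lt_one' ℝ) p s = s := (toIocMod_eq_self _).2 ⟨hs1, hs'.le⟩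
    rw [this, not_le]
    exact ⟨fun h => ⟨hs1, h⟩, fun h => h.2⟩

lemma sbtw_coe {p s t : ℝ} (hs : p < s) (hst : s < t) (ht : t < p + 1) :
    sbtw (p : S1) s t :=
  (sbtw_coe_iff hs.le (by linarith) (by linarith) ht).2 ⟨hs, hst⟩

/-! ### Chords and orientation in the plane -/

/-- The point of the unit circle with coordinate `s ∈ ℝ`. -/
noncomputable def pt (s : ℝ) : ℂ := toPlane (s : S1)

lemma pt_re (s : ℝ) : (pt s).re = Real.cos (2 * Real.pi * s) := by
  simp [pt, toPlane, AddCircle.toCircle_apply_mk, Circle.coe_exp,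
    -Complex.ofReal_ofNat, -Complex.ofReal_mul, Complex.exp_ofReal_mul_I_re]

lemma pt_im (s : ℝ) : (pt s).im = Real.sin (2 * Real.pi * s) := by
  simp [pt, toPlane, AddCircle.toCircle_apply_mk, Circle.coe_exp,
    -Complex.ofReal_ofNat, -Complex.ofReal_mul, Complex.exp_ofReal_mul_I_im]

lemma norm_toPlane (x : S1) : ‖toPlane x‖ = 1 := Circle.norm_coe _

lemma norm_pt (s : ℝ) : ‖pt s‖ = 1 := norm_toPlane _

lemma toPlane_injective : Function.Injective toPlane := fun _ _ h =>
  AddCircle.injective_toCircle one_ne_zero (Subtype.ext h)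

lemma continuous_toPlane : Continuous toPlane :=
  continuous_subtype_val.comp AddCircle.continuous_toCircle

/-- Twice the signed area of the triangle `A B X`: it is positive if `X` lies to the left of the
oriented line from `A` to `B`. -/
noncomputable def cross (A B X : ℂ) : ℝ :=
  (B.re - A.re) * (X.im - A.im) - (B.im - A.im) * (X.re - A.re)

lemma continuous_cross (A B : ℂ) : Continuous (cross A B) := by
  unfold cross; fun_prop

lemma cross_combo (A B X Y : ℂ) {s t : ℝ} (h : s + t = 1) :
    cross A B (s • X + t • Y) = s * cross A B X + t * cross A B Y := by
  obtain rfl : s = 1 - t := by linarith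
  simp only [cross, Complex.add_re, Complex.add_im, Complex.real_smul, Complex.re_ofReal_mul,
    Complex.im_ofReal_mul]
  ring

lemma cross_left (A B : ℂ) : cross A B A = 0 := by simp [cross]

lemma cross_right (A B : ℂ) : cross A B B = 0 := by simp [cross]; ring

lemma cross_add_normal (A B X : ℂ) (τ : ℝ) :
    cross A B (X + τ • (Complex.I * (B - A))) = cross A B X + τ * ‖B - A‖ ^ 2 := by
  rw [← Complex.normSq_eq_norm_sq, Complex.normSq_apply]
  simp [cross, Complex.real_smul]
  ring

lemma cross_pt (a b c : ℝ) : cross (pt a) (pt b) (pt c) =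
    4 * Real.sin (Real.pi * (b - a)) * Real.sin (Real.pi * (c - b)) *
      Real.sin (Real.pi * (c - a)) := by
  have h1 : cross (pt a) (pt b) (pt c) = Real.sin (2 * Real.pi * b - 2 * Real.pi * a)
      + Real.sin (2 * Real.pi * c - 2 * Real.pi * b)
      - Real.sin (2 * Real.pi * c - 2 * Real.pi * a) := by
    simp only [cross, pt_re, pt_im, Real.sin_sub]; ring
  rw [h1]
  set u := Real.pi * (b - a)
  set v := Real.pi * (c - b)
  have e1 : 2 * Real.pi * b - 2 * Real.pi * a = 2 * u := by simp only [u]; ring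
  have e2 : 2 * Real.pi * c - 2 * Real.pi * b = 2 * v := by simp only [v]; ring
  have e3 : 2 * Real.pi * c - 2 * Real.pi * a = 2 * (u + v) := by simp only [u, v]; ring
  have e4 : Real.pi * (c - a) = u + v := by simp only [u, v]; ring
  rw [e1, e2, e3, e4, Real.sin_two_mul, Real.sin_two_mul, Real.sin_two_mul, Real.sin_add,
    Real.cos_add]
  have hu := Real.sin_sq_add_cos_sq u
  have hv := Real.sin_sq_add_cos_sq v
  linear_combination (-2 * Real.sin u * Real.cos u) * hv - 2 * Real.sin v * Real.cos v * hu

lemma sin_pi_mul_pos {x : ℝ} (h0 : 0 < x) (h1 : x < 1) : 0 < Real.sin (Real.pi * x) := by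
  apply Real.sin_pos_of_pos_of_lt_pi
  · exact mul_pos Real.pi_pos h0
  · nlinarith [Real.pi_pos]

lemma cross_pt_pos {a b c : ℝ} (hab : a < b) (hbc : b < c) (hca : c < a + 1) :
    0 < cross (pt a) (pt b) (pt c) := by
  rw [cross_pt]
  have h1 := sin_pi_mul_pos (x := b - a) (by linarith) (by linarith)
  have h2 := sin_pi_mul_pos (x := c - b) (by linarith) (by linarith)
  have h3 := sin_pi_mul_pos (x := c - a) (by linarith) (by linarith)
  positivity

lemma pt_add_one (s : ℝ) : pt (s + 1) = pt s := by rw [pt, pt, coe_add_one]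

lemma cross_pt_neg {a b c : ℝ} (hac : a < c) (hcb : c < b) (hba : b < a + 1) :
    cross (pt a) (pt b) (pt c) < 0 := by
  have h := cross_pt_pos hac hcb hba
  simp only [cross] at h ⊢
  linarith

/-- The two arcs between `a` and `b` are distinguished by the sign of `cross`. -/
lemma cross_pt_cases {a b : ℝ} (hab : a < b) (hba : b < a + 1) (x : S1) :
    (x = a ∨ x = b) ∨ (∃ t : ℝ, a < t ∧ t < b ∧ (t : S1) = x ∧
        cross (pt a) (pt b) (toPlane x) < 0) ∨
      ∃ t : ℝ, b < t ∧ t < a + 1 ∧ (t : S1) = x ∧ 0 < cross (pt a) (pt b) (toPlane x) := by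
  obtain ⟨t, h1, h2, rfl⟩ := exists_rep a x
  rcases eq_or_lt_of_le h1 with rfl | h1
  · exact Or.inl (Or.inl rfl)
  rcases lt_trichotomy t b with h | rfl | h
  · exact Or.inr (Or.inl ⟨t, h1, h, rfl, cross_pt_neg h1 h hba⟩)
  · exact Or.inl (Or.inr rfl)
  · exact Or.inr (Or.inr ⟨t, h, h2, rfl, cross_pt_pos hab h h2⟩)

/-- A point of the open disk on the line through two points of the circle lies on the chord. -/
lemma mem_segment_of_cross_eq_zero {A B X : ℂ} (hA : ‖A‖ = 1) (hB : ‖B‖ = 1) (hAB : A ≠ B)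
    (hX : ‖X‖ < 1) (h : cross A B X = 0) : X ∈ segment ℝ A B := by
  have hd : 0 < Complex.normSq (B - A) := Complex.normSq_pos.2 (sub_ne_zero.2 hAB.symm)
  have nA : A.re * A.re + A.im * A.im = 1 := by
    rw [← Complex.normSq_apply, Complex.normSq_eq_norm_sq, hA]; norm_num
  have nB : B.re * B.re + B.im * B.im = 1 := by
    rw [← Complex.normSq_apply, Complex.normSq_eq_norm_sq, hB]; norm_num
  have nX : X.re * X.re + X.im * X.im < 1 := by
    rw [← Complex.normSq_apply, Complex.normSq_eq_norm_sq]
    nlinarith [norm_nonneg X]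
  have hd' : Complex.normSq (B - A) =
      (B.re - A.re) * (B.re - A.re) + (B.im - A.im) * (B.im - A.im) := by
    rw [Complex.normSq_apply]; simp
  set d := Complex.normSq (B - A)
  set τ := ((B.re - A.re) * (X.re - A.re) + (B.im - A.im) * (X.im - A.im)) / d with hτ
  have hτd : τ * d = (B.re - A.re) * (X.re - A.re) + (B.im - A.im) * (X.im - A.im) := by
    rw [hτ]; field_simp
  simp only [cross] at h
  have hre : X.re = A.re + τ * (B.re - A.re) := by
    have : (X.re - A.re) * d = τ * (B.re - A.re) * d := by
      rw [hd']
      rw [hd'] at hτd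
      linear_combination (-(B.re - A.re)) * hτd - (B.im - A.im) * h
    have := mul_right_cancel₀ hd.ne' this
    linarith
  have him : X.im = A.im + τ * (B.im - A.im) := by
    have : (X.im - A.im) * d = τ * (B.im - A.im) * d := by
      rw [hd']
      rw [hd'] at hτd
      linear_combination (-(B.im - A.im)) * hτd + (B.re - A.re) * h
    have := mul_right_cancel₀ hd.ne' this
    linarith
  have key : X.re * X.re + X.im * X.im = 1 - τ * (1 - τ) * d := by
    rw [hre, him, hd']
    linear_combination (1 - τ) * nA + τ * nB
  have hpos : 0 < τ * (1 - τ) := by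
    by_contra hcon
    push Not at hcon
    nlinarith
  have h0 : 0 < τ := by
    by_contra hcon
    push Not at hcon
    nlinarith
  have h1 : τ < 1 := by
    by_contra hcon
    push Not at hcon
    nlinarith
  refine ⟨1 - τ, τ, by linarith, h0.le, by ring, ?_⟩
  apply Complex.ext
  · simp [hre]; ring
  · simp [him]; ring

lemma combo_norm_lt {A B : ℂ} (hA : ‖A‖ = 1) (hB : ‖B‖ = 1) (hAB : A ≠ B) {s t : ℝ} (hs : 0 < s)
    (ht : 0 < t) (hst : s + t = 1) : ‖s • A + t • B‖ < 1 := by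
  have h := (strictConvex_closedBall ℝ (0 : ℂ) 1) (x := A) (y := B) (by simp [hA]) (by simp [hB])
    hAB hs ht hst
  rw [interior_closedBall _ one_ne_zero] at h
  simpa using h

/-- A point of the circle in the convex hull of a set of points of the circle is one of them. -/
lemma mem_of_toPlane_mem_convexHull {V : Set S1} {x : S1}
    (h : toPlane x ∈ convexHull ℝ (toPlane '' V)) : x ∈ V := by
  by_contra hx
  have nx : (toPlane x).re * (toPlane x).re + (toPlane x).im * (toPlane x).im = 1 := by
    rw [← Complex.normSq_apply, Complex.normSq_eq_norm_sq, norm_toPlane]; norm_num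
  let f : ℂ →ₗ[ℝ] ℝ := (toPlane x).re • Complex.reLm + (toPlane x).im • Complex.imLm
  have hconv : Convex ℝ {z : ℂ | f z < 1} := convex_halfSpace_lt f.isLinear 1
  have hsub : toPlane '' V ⊆ {z : ℂ | f z < 1} := by
    rintro _ ⟨v, hv, rfl⟩
    have hne : toPlane v ≠ toPlane x := fun e => hx (toPlane_injective e ▸ hv)
    have nv : (toPlane v).re * (toPlane v).re + (toPlane v).im * (toPlane v).im = 1 := by
      rw [← Complex.normSq_apply, Complex.normSq_eq_norm_sq, norm_toPlane]; norm_num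
    have hd : 0 < Complex.normSq (toPlane v - toPlane x) :=
      Complex.normSq_pos.2 (sub_ne_zero.2 hne)
    rw [Complex.normSq_apply, Complex.sub_re, Complex.sub_im] at hd
    simp only [f, mem_ofPred_eq, LinearMap.add_apply, LinearMap.smul_apply, Complex.reLm_coe,
      Complex.imLm_coe, smul_eq_mul]
    nlinarith
  have := convexHull_min hsub hconv h
  simp only [f, mem_ofPred_eq, LinearMap.add_apply, LinearMap.smul_apply, Complex.reLm_coe,
      Complex.imLm_coe, smul_eq_mul] at this
  linarith

/-! ### Leaves and gaps in real coordinates -/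

namespace Lamination

variable (L : Lamination)

/-- The leaf relation lifted to the universal cover `ℝ` of the circle. -/
def Rel (s t : ℝ) : Prop := ((s : S1), (t : S1)) ∈ L.leaves

variable {L}

lemma Rel.symm {s t : ℝ} (h : L.Rel s t) : L.Rel t s := L.symm _ _ h

lemma rel_add_one_left {s t : ℝ} : L.Rel (s + 1) t ↔ L.Rel s t := by
  simp only [Rel, coe_add_one]

lemma rel_add_one_right {s t : ℝ} : L.Rel s (t + 1) ↔ L.Rel s t := by
  simp only [Rel, coe_add_one]

lemma Rel.not_link {s t u v : ℝ} (h : L.Rel s t) (h' : L.Rel u v) (h1 : s < u) (h2 : u < t)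
    (h3 : t < v) (h4 : v < s + 1) : False := by
  refine L.unlinked _ _ _ _ h h' (Or.inl ⟨?_, ?_⟩)
  · exact sbtw_coe h1 h2 (by linarith)
  · rw [mem_cIoo, ← coe_add_one s]
    exact sbtw_coe h3 h4 (by linarith)

variable (L)

lemma isClosed_leaves_union_diagonal : IsClosed (L.leaves ∪ diagonal S1) := by
  obtain ⟨T, hT, hTL⟩ := isClosed_induced_iff.1 L.closed
  have : L.leaves ∪ diagonal S1 = T ∪ diagonal S1 := by
    ext z
    by_cases hz : z.1 = z.2
    · simp [hz]
    · have := congrArg (fun s => (⟨z, hz⟩ : {z : S1 × S1 // z.1 ≠ z.2}) ∈ s) hTL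
      simp only [mem_preimage, eq_iff_iff] at this
      simp [hz, this]
  rw [this]
  exact hT.union isClosed_diagonal

variable {L}

lemma rel_of_tendsto {a b : ℕ → ℝ} {s t : ℝ} (ha : Tendsto a atTop (𝓝 s))
    (hb : Tendsto b atTop (𝓝 t)) (h : ∀ n, L.Rel (a n) (b n)) (hst : s < t) (hts : t < s + 1) :
    L.Rel s t := by
  have hc : Continuous ((↑) : ℝ → S1) := AddCircle.continuous_mk' 1
  have := L.isClosed_leaves_union_diagonal.mem_of_tendsto
    (((hc.tendsto s).comp ha).prodMk_nhds ((hc.tendsto t).comp hb))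
    (Eventually.of_forall fun n => Or.inl (h n))
  rcases this with h | h
  · exact h
  · exact absurd (coe_inj_of_near (by linarith) hts h) hst.ne

end Lamination

lemma isClosed_chords {C : Set (S1 × S1)} (hC : IsClosed C) :
    IsClosed {w | ∃ a b : S1, (a, b) ∈ C ∧ w ∈ chord a b} := by
  have : {w | ∃ a b : S1, (a, b) ∈ C ∧ w ∈ chord a b} =
      (fun q : (S1 × S1) × ℝ => (1 - q.2) • toPlane q.1.1 + q.2 • toPlane q.1.2) ''
        (C ×ˢ Icc (0 : ℝ) 1) := by
    ext w
    simp only [chord, segment_eq_image, mem_ofPred_eq, mem_image, mem_prod, Prod.exists]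
    constructor
    · rintro ⟨a, b, h, t, ht, rfl⟩
      exact ⟨a, b, t, ⟨h, ht⟩, rfl⟩
    · rintro ⟨a, b, t, ⟨h, ht⟩, rfl⟩
      exact ⟨a, b, h, t, ht, rfl⟩
  rw [this]
  refine ((hC.isCompact.prod isCompact_Icc).image ?_).isClosed
  have := continuous_toPlane
  fun_prop

namespace Lamination

variable (L : Lamination)

/-- The complement of the leaves in the open disk is open: the leaves together with the
degenerate chords, which lie on the unit circle, form a compact family. -/
lemma isOpen_ball_diff_support : IsOpen (Metric.ball (0 : ℂ) 1 \ L.support) := by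
  have : Metric.ball (0 : ℂ) 1 \ L.support = Metric.ball (0 : ℂ) 1 \
      {w | ∃ a b : S1, (a, b) ∈ L.leaves ∪ diagonal S1 ∧ w ∈ chord a b} := by
    ext w
    simp only [Set.mem_sdiff, support, mem_ofPred_eq]
    refine and_congr_right fun hw => not_congr ⟨?_, ?_⟩
    · rintro ⟨a, b, h, h'⟩
      exact ⟨a, b, Or.inl h, h'⟩
    · rintro ⟨a, b, h | h, h'⟩
      · exact ⟨a, b, h, h'⟩
      · obtain rfl : a = b := h
        rw [chord, segment_same, mem_singleton_iff] at h'
        rw [h', mem_ball_zero_iff, norm_toPlane] at hw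
        exact absurd hw (lt_irrefl _)
  rw [this]
  exact Metric.isOpen_ball.sdiff (isClosed_chords L.isClosed_leaves_union_diagonal)

variable {L}

/-- A gap lies on one side of every leaf. -/
lemma cross_nonneg_or_nonpos_of_isGap {a b : S1} (h : (a, b) ∈ L.leaves) {P : Set ℂ}
    (hP : L.IsGap P) :
    (∀ x ∈ P, 0 ≤ cross (toPlane a) (toPlane b) x) ∨
      (∀ x ∈ P, cross (toPlane a) (toPlane b) x ≤ 0) := by
  obtain ⟨z, hz, rfl⟩ := hP
  set Ω := connectedComponentIn (Metric.ball (0 : ℂ) 1 \ L.support) z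
  have hsub : Ω ⊆ Metric.ball (0 : ℂ) 1 \ L.support := connectedComponentIn_subset _ _
  have hne : ∀ x ∈ Ω, cross (toPlane a) (toPlane b) x ≠ 0 := by
    intro x hx h0
    refine (hsub hx).2 ⟨a, b, h, ?_⟩
    exact mem_segment_of_cross_eq_zero (norm_toPlane _) (norm_toPlane _)
      (fun e => L.ne _ _ h (toPlane_injective e)) (by simpa using (hsub hx).1) h0
  have hcont := continuous_cross (toPlane a) (toPlane b)
  have hpre : IsPreconnected (cross (toPlane a) (toPlane b) '' Ω) :=
    isPreconnected_connectedComponentIn.image _ hcont.continuousOn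
  by_cases hpos : ∀ x ∈ Ω, 0 ≤ cross (toPlane a) (toPlane b) x
  · left
    exact fun x hx => closure_minimal (t := {x | 0 ≤ cross (toPlane a) (toPlane b) x}) hpos
      (isClosed_le continuous_const hcont) hx
  · right
    push Not at hpos
    obtain ⟨y, hy, hy0⟩ := hpos
    have hneg : ∀ x ∈ Ω, cross (toPlane a) (toPlane b) x ≤ 0 := by
      intro x hx
      by_contra hcon
      push Not at hcon
      obtain ⟨w, hw, hw0⟩ := hpre.Icc_subset (mem_image_of_mem _ hy) (mem_image_of_mem _ hx)
        ⟨hy0.le, hcon.le⟩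
      exact hne w hw hw0
    exact fun x hx => closure_minimal (t := {x | cross (toPlane a) (toPlane b) x ≤ 0}) hneg
      (isClosed_le hcont continuous_const) hx

/-- A supporting chord of a gap between two ideal points of the gap is a leaf. -/
lemma mem_leaves_of_supporting {P : Set ℂ} (hP : L.IsGap P) (hconv : Convex ℝ P) {a b : S1}
    (hab : a ≠ b) (ha : toPlane a ∈ P) (hb : toPlane b ∈ P)
    (hside : ∀ x ∈ P, 0 ≤ cross (toPlane a) (toPlane b) x) : (a, b) ∈ L.leaves := by
  have hP' := hP
  obtain ⟨z, hz, rfl⟩ := hP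
  set U := Metric.ball (0 : ℂ) 1 \ L.support
  set Ω := connectedComponentIn U z
  set A := toPlane a
  set B := toPlane b
  have hAB : A ≠ B := fun e => hab (toPlane_injective e)
  set m : ℂ := (1 / 2 : ℝ) • A + (1 / 2 : ℝ) • B
  have hm1 : ‖m‖ < 1 := combo_norm_lt (norm_toPlane _) (norm_toPlane _) hAB (by norm_num)
    (by norm_num) (by norm_num)
  have hmP : m ∈ closure Ω := hconv ha hb (by norm_num) (by norm_num) (by norm_num)
  have hm0 : cross A B m = 0 := by
    rw [cross_combo _ _ _ _ (by norm_num), cross_left, cross_right]; ring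
  have hms : m ∈ L.support := by
    by_contra hcon
    have hmU : m ∈ U := ⟨by simpa using hm1, hcon⟩
    obtain ⟨ε, hε, hball⟩ := Metric.isOpen_iff.1 L.isOpen_ball_diff_support m hmU
    obtain ⟨x, hx, hxm⟩ := Metric.mem_closure_iff.1 hmP ε hε
    have hsub : Metric.ball m ε ⊆ Ω := by
      have h1 := (convex_ball m ε).isPreconnected.subset_connectedComponentIn
        (x := x) (by rw [Metric.mem_ball, dist_comm]; exact hxm) hball
      rwa [← connectedComponentIn_eq hx] at h1
    -- a small push of the midpoint across the chord stays in the ball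
    have hcont : Continuous fun τ : ℝ => m + τ • (Complex.I * (B - A)) := by fun_prop
    have hev : ∀ᶠ τ in 𝓝 (0 : ℝ), m + τ • (Complex.I * (B - A)) ∈ Metric.ball m ε := by
      apply hcont.continuousAt.eventually_mem
      simpa using Metric.ball_mem_nhds m hε
    obtain ⟨δ, hδ, hδ'⟩ := Metric.eventually_nhds_iff.1 hev
    have hin := hδ' (y := -(δ / 2)) (by
      rw [Real.dist_eq, sub_zero, abs_neg, abs_of_pos (by positivity)]; linarith)
    have h0 := hside _ (subset_closure (hsub hin))
    rw [cross_add_normal, hm0] at h0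
    have : 0 < ‖B - A‖ ^ 2 := by
      have := norm_pos_iff.2 (sub_ne_zero.2 hAB.symm)
      positivity
    nlinarith
  obtain ⟨c, d, hcd, hmcd⟩ := hms
  have hcdm : cross (toPlane c) (toPlane d) m = 0 := by
    obtain ⟨s, t, -, -, hst, hm⟩ := hmcd
    rw [← hm, cross_combo _ _ _ _ hst, cross_left, cross_right]; ring
  have hsum : cross (toPlane c) (toPlane d) m =
      (1 / 2) * cross (toPlane c) (toPlane d) A + (1 / 2) * cross (toPlane c) (toPlane d) B :=
    cross_combo _ _ _ _ (by norm_num)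
  have h2 : cross (toPlane c) (toPlane d) A = 0 ∧ cross (toPlane c) (toPlane d) B = 0 := by
    rcases cross_nonneg_or_nonpos_of_isGap hcd hP' with h | h
    · have h1 := h _ ha
      have h2 := h _ hb
      constructor <;> linarith
    · have h1 := h _ ha
      have h2 := h _ hb
      constructor <;> linarith
  have key : ∀ x : S1, cross (toPlane c) (toPlane d) (toPlane x) = 0 → x = c ∨ x = d := by
    intro x hx
    obtain ⟨u, -, -, rfl⟩ := exists_rep 0 c
    obtain ⟨v, hv1, hv2, rfl⟩ := exists_rep u d
    have huv : u < v := lt_of_le_of_ne hv1 (fun e => L.ne _ _ hcd (by rw [e]))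
    rcases cross_pt_cases huv hv2 x with h | ⟨t, -, -, -, h⟩ | ⟨t, -, -, -, h⟩
    · exact h
    · exact absurd hx h.ne
    · exact absurd hx h.ne'
  rcases key a h2.1 with rfl | rfl <;> rcases key b h2.2 with rfl | rfl
  · exact absurd rfl hab
  · exact hcd
  · exact L.symm _ _ hcd
  · exact absurd rfl hab

/-- The vertex set of a gap of a very full lamination. -/
lemma IsVeryFull.exists_vertices (hL : L.IsVeryFull) {P : Set ℂ} (hP : L.IsGap P) :
    ∃ V : Finset S1, 3 ≤ V.card ∧ Convex ℝ P ∧ P = convexHull ℝ (toPlane '' (V : Set S1)) ∧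
      ∀ x : S1, toPlane x ∈ P ↔ x ∈ V := by
  obtain ⟨V, hV, rfl⟩ := hL P hP
  refine ⟨V, hV, convex_convexHull _ _, rfl, fun x => ⟨fun h => ?_, fun h => ?_⟩⟩
  · exact mem_of_toPlane_mem_convexHull h
  · exact subset_convexHull _ _ (mem_image_of_mem _ h)

/-- The successor of a vertex of a gap, in the circular order of the vertices, is joined to it
by a leaf. -/
lemma IsVeryFull.exists_next_vertex (hL : L.IsVeryFull) {P : Set ℂ} (hP : L.IsGap P) {a u : ℝ}
    (ha : pt a ∈ P) (hu : pt u ∈ P) (hau : a < u) (hua : u < a + 1) :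
    ∃ v, a < v ∧ v ≤ u ∧ pt v ∈ P ∧ L.Rel a v := by
  obtain ⟨V, -, hconv, hPV, hV⟩ := hL.exists_vertices hP
  let S : Set ℝ := {t | t ∈ Ioo a (a + 1) ∧ (t : S1) ∈ V}
  have hfin : S.Finite := by
    refine Set.Finite.of_finite_image (f := fun t : ℝ => (t : S1)) ?_ ?_
    · exact V.finite_toSet.subset (by rintro _ ⟨t, ht, rfl⟩; exact ht.2)
    · intro s hs t ht hst
      exact coe_inj_of_near (by linarith [hs.1.2, ht.1.1]) (by linarith [hs.1.1, ht.1.2]) hst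
  have huS : u ∈ S := ⟨⟨hau, hua⟩, (hV _).1 hu⟩
  obtain ⟨v, hvS, hv⟩ := S.exists_min_image id hfin ⟨u, huS⟩
  have hvP : pt v ∈ P := (hV _).2 hvS.2
  refine ⟨v, hvS.1.1, hv u huS, hvP, ?_⟩
  refine mem_leaves_of_supporting hP hconv ?_ ha hvP ?_
  · exact fun e => hvS.1.1.ne (coe_inj_of_near (by linarith [hvS.1.1]) hvS.1.2 e)
  · have hhs : Convex ℝ {x : ℂ | 0 ≤ cross (pt a) (pt v) x} := by
      intro x hx y hy s t hs ht hst
      simp only [mem_ofPred_eq] at hx hy ⊢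
      rw [cross_combo _ _ _ _ hst]
      positivity
    have hsub : P ⊆ {x : ℂ | 0 ≤ cross (pt a) (pt v) x} := by
      rw [hPV]
      refine convexHull_min ?_ hhs
      rintro _ ⟨x, hx, rfl⟩
      rcases cross_pt_cases hvS.1.1 hvS.1.2 x with h | ⟨t, h1, h2, rfl, -⟩ | ⟨t, -, -, -, h⟩
      · rcases h with rfl | rfl
        · exact (cross_left _ _).ge
        · exact (cross_right _ _).ge
      · exact absurd (hv t ⟨⟨h1, h2.trans hvS.1.2⟩, hx⟩) (not_le.2 h2)
      · exact h.le
    exact fun x hx => hsub hx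

/-- No three leaves of a loose lamination share an endpoint: a gap with the two outer ones as
edges would lie on both sides of the middle one. -/
lemma IsLoose.not_three (hL : L.IsLoose) {p a b c : ℝ} (hpa : p < a) (hab : a < b) (hbc : b < c)
    (hcp : c < p + 1) (ha : L.Rel p a) (hb : L.Rel p b) (hc : L.Rel p c) : False := by
  have hac : (a : S1) ≠ c := fun e =>
    (hab.trans hbc).ne (coe_inj_of_near (by linarith) (by linarith) e)
  obtain ⟨P, h1, h2⟩ := hL _ _ _ ha hc hac
  have haP : pt a ∈ P := h1.2.2 (right_mem_segment _ _ _)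
  have hcP : pt c ∈ P := h2.2.2 (right_mem_segment _ _ _)
  have hneg := cross_pt_neg hpa hab (by linarith : b < p + 1)
  have hpos := cross_pt_pos (hpa.trans hab) hbc hcp
  rcases cross_nonneg_or_nonpos_of_isGap hb h1.2.1 with h | h
  · exact absurd (h _ haP) (not_le.2 hneg)
  · exact absurd (h _ hcP) (not_le.2 hpos)

/-- A chain of leaves that goes around the circle less than once is finite: all its points are
vertices of one gap. -/
lemma not_chain (hF : L.IsVeryFull) (hL : L.IsLoose) {y : ℕ → ℝ} (hy : StrictMono y)
    (hy1 : ∀ n, y n < y 0 + 1) (h : ∀ n, L.Rel (y n) (y (n + 1))) : False := by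
  have hinj : ∀ i j, (y i : S1) = y j → i = j := by
    intro i j hij
    have h0 := hy.monotone (Nat.zero_le i)
    have h0' := hy.monotone (Nat.zero_le j)
    exact hy.injective (coe_inj_of_near (by linarith [hy1 i]) (by linarith [hy1 j]) hij)
  obtain ⟨P, h1, h2⟩ := hL _ _ _ (h 0).symm (h 1) (fun e => by simpa using hinj _ _ e)
  obtain ⟨V, -, -, -, hV⟩ := hF.exists_vertices h1.2.1
  have hy0P : pt (y 0) ∈ P := h1.2.2 (right_mem_segment _ _ _)
  have hmem : ∀ n, pt (y (n + 1)) ∈ P ∧ pt (y (n + 2)) ∈ P := by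
    intro n
    induction n with
    | zero => exact ⟨h1.2.2 (left_mem_segment _ _ _), h2.2.2 (right_mem_segment _ _ _)⟩
    | succ n ih =>
      refine ⟨ih.2, ?_⟩
      have hlt : y 0 < y (n + 1) := hy (by omega)
      have hlt1 : y (n + 1) < y (n + 2) := hy (by omega)
      have hlt2 : y (n + 2) < y (n + 3) := hy (by omega)
      have hb := hy1 (n + 2)
      have hb' := hy1 (n + 3)
      obtain ⟨v, hv1, hv2, hvP, hv⟩ := hF.exists_next_vertex h1.2.1 ih.2
        (u := y 0 + 1) (by rw [pt_add_one]; exact hy0P) hb (by linarith)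
      have r1 : L.Rel (y (n + 2)) (y (n + 1) + 1) := rel_add_one_right.2 (h (n + 1)).symm
      have r2 : L.Rel (y (n + 2)) (y (n + 3)) := h (n + 2)
      rcases lt_trichotomy v (y (n + 3)) with hlt3 | heq | hlt3
      · exact (hL.not_three hv1 hlt3 (by linarith) (by linarith) hv r2 r1).elim
      · rw [heq] at hvP; exact hvP
      · exact (hL.not_three hlt2 hlt3 (by linarith) (by linarith) r2 hv r1).elim
  have hfin : (range fun n => (y (n + 1) : S1)).Finite :=
    V.finite_toSet.subset (by rintro _ ⟨n, rfl⟩; exact (hV _).1 (hmem n).1)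
  exact Set.infinite_range_of_injective (fun i j hij => by simpa using hinj _ _ hij) hfin

end Lamination

namespace Lamination

variable {L : Lamination}

/-! ### Leaves accumulating at a point of the circle or at a leaf -/

lemma exists_isGap_of_isPreconnected {I : Set ℂ} (hI : IsPreconnected I) (hne : I.Nonempty)
    (hsub : I ⊆ Metric.ball (0 : ℂ) 1 \ L.support) : ∃ P, L.IsGap P ∧ closure I ⊆ P := by
  obtain ⟨z, hz⟩ := hne
  exact ⟨_, ⟨z, hsub hz, rfl⟩, closure_mono (hI.subset_connectedComponentIn hz hsub)⟩

lemma isOpen_coe_Ioo (a b : ℝ) : IsOpen (((↑) : ℝ → S1) '' Ioo a b) :=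
  QuotientAddGroup.isOpenMap_coe _ isOpen_Ioo

lemma cross_zero_pt (p s : ℝ) : cross 0 (pt p) (pt s) = Real.sin (2 * Real.pi * (s - p)) := by
  rw [mul_sub, Real.sin_sub]
  simp only [cross, pt_re, pt_im, Complex.zero_re, Complex.zero_im]
  ring

lemma combo_neg {s t x y : ℝ} (hs : 0 ≤ s) (ht : 0 ≤ t) (hst : s + t = 1) (hx : x < 0)
    (hy : y < 0) : s * x + t * y < 0 := by
  rcases eq_or_lt_of_le hs with rfl | hs
  · obtain rfl : t = 1 := by linarith
    linarith
  · nlinarith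

/-- A point that is not an endpoint of a leaf is surrounded by arbitrarily short leaves. If the
radius towards `p` met no leaf near `p`, it would end in a gap with `p` as a vertex; if it meets
leaves arbitrarily close to `p`, these leaves shrink to `p`, by compactness. -/
lemma IsVeryFull.exists_short_leaf (hF : L.IsVeryFull) {p : ℝ} (hp : ∀ t, ¬ L.Rel p t) {ε : ℝ}
    (hε : 0 < ε) : ∃ a b, p - ε < a ∧ a < p ∧ p < b ∧ b < p + ε ∧ L.Rel a b := by
  wlog hε4 : ε ≤ 1 / 4 generalizing ε
  · obtain ⟨a, b, h1, h2, h3, h4, h5⟩ := this (ε := 1 / 4) (by norm_num) le_rfl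
    exact ⟨a, b, by linarith, h2, h3, by linarith, h5⟩
  have hp' : ∀ x : S1, ((p : S1), x) ∉ L.leaves := by
    intro x hx
    obtain ⟨t, -, -, rfl⟩ := exists_rep 0 x
    exact hp t hx
  set N : Set S1 := ((↑) : ℝ → S1) '' Ioo (p - ε) (p + ε) with hN
  have hNo : IsOpen N := isOpen_coe_Ioo _ _
  have hpN : (p : S1) ∈ N := mem_image_of_mem _ ⟨by linarith, by linarith⟩
  -- the leaves that are not short; together with degenerate chords they form a compact family,
  -- and none of their chords passes through `p`
  set C : Set (S1 × S1) := (L.leaves ∪ diagonal S1) \ (N ×ˢ N)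
  have hCc : IsClosed C := L.isClosed_leaves_union_diagonal.sdiff (hNo.prod hNo)
  have hnot : pt p ∈ {w | ∃ a b : S1, (a, b) ∈ C ∧ w ∈ chord a b}ᶜ := by
    rintro ⟨a, b, ⟨hab, habN⟩, hw⟩
    rcases hab with hab | hab
    · obtain ⟨s, t, hs, ht, hst, hw⟩ := hw
      have hne : toPlane a ≠ toPlane b := fun e => L.ne _ _ hab (toPlane_injective e)
      rcases eq_or_lt_of_le hs with rfl | hs
      · obtain rfl : t = 1 := by linarith
        rw [zero_smul, zero_add, one_smul] at hw
        rw [toPlane_injective hw] at hab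
        exact hp' _ (L.symm _ _ hab)
      rcases eq_or_lt_of_le ht with rfl | ht
      · obtain rfl : s = 1 := by linarith
        rw [zero_smul, add_zero, one_smul] at hw
        rw [toPlane_injective hw] at hab
        exact hp' _ hab
      have := combo_norm_lt (norm_toPlane a) (norm_toPlane b) hne hs ht hst
      rw [hw, norm_pt] at this
      exact lt_irrefl _ this
    · obtain rfl : a = b := hab
      rw [chord, segment_same, mem_singleton_iff] at hw
      rw [← toPlane_injective hw] at habN
      exact habN ⟨hpN, hpN⟩
  have hcont : Continuous fun r : ℝ => r • pt p := by fun_prop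
  have hev : ∀ᶠ r in 𝓝 (1 : ℝ), r • pt p ∈ {w | ∃ a b : S1, (a, b) ∈ C ∧ w ∈ chord a b}ᶜ := by
    apply hcont.continuousAt.eventually_mem
    rw [one_smul]
    exact (isClosed_chords hCc).isOpen_compl.mem_nhds hnot
  obtain ⟨r₀, hr₀, hr₀'⟩ := exists_Ioc_subset_of_mem_nhds hev ⟨0, zero_lt_one⟩
  set r₁ := max r₀ 0
  have hr₁ : r₁ < 1 := max_lt hr₀ zero_lt_one
  have hr1pos : 0 ≤ r₁ := le_max_right _ _
  by_cases hex : ∃ r ∈ Ioo r₁ 1, r • pt p ∈ L.support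
  · obtain ⟨r, hr, a, b, hab, hw⟩ := hex
    have hCab : (a, b) ∉ C := fun h =>
      hr₀' ⟨(le_max_left _ _).trans_lt hr.1, hr.2.le⟩ ⟨a, b, h, hw⟩
    have hN2 : (a, b) ∈ N ×ˢ N := by
      by_contra hcon
      exact hCab ⟨Or.inl hab, hcon⟩
    obtain ⟨⟨α, hα, rfl⟩, β, hβ, rfl⟩ := hN2
    obtain ⟨s, t, hs, ht, hst, hw⟩ := hw
    have hcr : s * Real.sin (2 * Real.pi * (α - p)) + t * Real.sin (2 * Real.pi * (β - p)) = 0 := by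
      rw [← cross_zero_pt, ← cross_zero_pt, ← cross_combo _ _ _ _ hst]
      change cross 0 (pt p) (s • toPlane α + t • toPlane β) = 0
      rw [hw]
      simp [cross]; ring
    have hpos : ∀ x, p < x → x < p + ε → 0 < Real.sin (2 * Real.pi * (x - p)) := by
      intro x h1 h2
      have := sin_pi_mul_pos (x := 2 * (x - p)) (by linarith) (by linarith)
      rwa [← mul_assoc, mul_comm Real.pi 2] at this
    have hneg : ∀ x, p - ε < x → x < p → Real.sin (2 * Real.pi * (x - p)) < 0 := by
      intro x h1 h2
      have := hpos (2 * p - x) (by linarith) (by linarith)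
      rw [show 2 * Real.pi * (2 * p - x - p) = -(2 * Real.pi * (x - p)) by ring,
        Real.sin_neg] at this
      linarith
    rcases lt_trichotomy α p with hα1 | rfl | hα1
    · rcases lt_trichotomy β p with hβ1 | rfl | hβ1
      · exact absurd hcr (combo_neg hs ht hst (hneg α hα.1 hα1) (hneg β hβ.1 hβ1)).ne
      · exact (hp' _ (L.symm _ _ hab)).elim
      · exact ⟨α, β, hα.1, hα1, hβ1, hβ.2, hab⟩
    · exact (hp' _ hab).elim
    · rcases lt_trichotomy β p with hβ1 | rfl | hβ1
      · exact ⟨β, α, hβ.1, hβ1, hα1, hα.2, L.symm _ _ hab⟩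
      · exact (hp' _ (L.symm _ _ hab)).elim
      · have := combo_neg hs ht hst (neg_lt_zero.2 (hpos α hα1 hα.2))
          (neg_lt_zero.2 (hpos β hβ1 hβ.2))
        linarith
  · push Not at hex
    obtain ⟨P, hP, hPI⟩ := exists_isGap_of_isPreconnected (L := L)
      (I := (fun r : ℝ => r • pt p) '' Ioo r₁ 1)
      (isPreconnected_Ioo.image _ hcont.continuousOn) ((nonempty_Ioo.2 hr₁).image _) (by
        rintro _ ⟨r, hr, rfl⟩
        refine ⟨?_, hex r hr⟩
        have h0 : 0 < r := lt_of_le_of_lt hr1pos hr.1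
        rw [mem_ball_zero_iff, norm_smul, norm_pt, mul_one, Real.norm_of_nonneg h0.le]
        exact hr.2)
    have hpP : pt p ∈ P := by
      apply hPI
      have h1 : (1 : ℝ) ∈ closure (Ioo r₁ 1) := by
        rw [closure_Ioo hr₁.ne]; exact ⟨hr₁.le, le_rfl⟩
      have := image_closure_subset_closure_image hcont (mem_image_of_mem _ h1)
      simpa using this
    obtain ⟨V, hV3, -, -, hV⟩ := hF.exists_vertices hP
    obtain ⟨x, hxV, hxp⟩ := Finset.exists_mem_ne (by omega : 1 < V.card) (p : S1)
    obtain ⟨u, hu1, hu2, rfl⟩ := exists_rep p x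
    have hpu : p < u := lt_of_le_of_ne hu1 (fun e => hxp (by rw [e]))
    obtain ⟨v, -, -, -, hv⟩ := hF.exists_next_vertex hP hpP ((hV _).2 hxV) hpu hu2
    exact (hp v hv).elim

/-- A leaf through an interior point of the chord of another leaf has the same endpoints. -/
lemma eq_of_chords_meet {p q : ℝ} (hpq : p < q) (hqp : q < p + 1) (h : L.Rel p q) {a b : S1}
    (hab : (a, b) ∈ L.leaves) {m : ℂ} (hm : ‖m‖ < 1) (hm0 : cross (pt p) (pt q) m = 0)
    (hmab : m ∈ chord a b) : (a = p ∧ b = q) ∨ (a = q ∧ b = p) := by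
  obtain ⟨s, t, hs, ht, hst, rfl⟩ := hmab
  have hcr := hm0
  rw [cross_combo _ _ _ _ hst] at hcr
  have hs0 : s ≠ 0 := by
    rintro rfl
    obtain rfl : t = 1 := by linarith
    rw [zero_smul, zero_add, one_smul, norm_toPlane] at hm
    exact lt_irrefl _ hm
  have ht0 : t ≠ 0 := by
    rintro rfl
    obtain rfl : s = 1 := by linarith
    rw [zero_smul, add_zero, one_smul, norm_toPlane] at hm
    exact lt_irrefl _ hm
  have hs' : 0 < s := lt_of_le_of_ne hs hs0.symm
  have ht' : 0 < t := lt_of_le_of_ne ht ht0.symm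
  have hz : ∀ x : S1, (x = p ∨ x = q) → cross (pt p) (pt q) (toPlane x) = 0 := by
    rintro x (rfl | rfl)
    · exact cross_left _ _
    · exact cross_right _ _
  have hne := L.ne _ _ hab
  rcases cross_pt_cases hpq hqp a with ha | ⟨α, h1, h2, rfl, ha⟩ | ⟨α, h1, h2, rfl, ha⟩ <;>
  rcases cross_pt_cases hpq hqp b with hb | ⟨β, h3, h4, rfl, hb⟩ | ⟨β, h3, h4, rfl, hb⟩
  · rcases ha with rfl | rfl <;> rcases hb with rfl | rfl
    · exact absurd rfl hne
    · exact Or.inl ⟨rfl, rfl⟩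
    · exact Or.inr ⟨rfl, rfl⟩
    · exact absurd rfl hne
  · rw [hz a ha] at hcr; nlinarith
  · rw [hz a ha] at hcr; nlinarith
  · rw [hz b hb] at hcr; nlinarith
  · nlinarith
  · exact (Rel.not_link h hab h1 h2 h3 h4).elim
  · rw [hz b hb] at hcr; nlinarith
  · exact (Rel.not_link h (Rel.symm hab) h3 h4 h1 h2).elim
  · nlinarith

/-- Either there is a gap along the leaf `(p, q)` on the side of the arc from `p` to `q`, so that
`p` is an endpoint of a further leaf on that side, or the leaf is a limit of leaves from there. -/
lemma IsVeryFull.exists_adjacent_leaf (hF : L.IsVeryFull) {p q : ℝ} (hpq : p < q)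
    (hqp : q < p + 1) (h : L.Rel p q) {ε : ℝ} (hε : 0 < ε) :
    (∃ v, p < v ∧ v < q ∧ L.Rel p v) ∨
      ∃ s t, p ≤ s ∧ s < p + ε ∧ q - ε < t ∧ t ≤ q ∧ L.Rel s t ∧ (p < s ∨ t < q) := by
  wlog hε4 : ε ≤ (q - p) / 2 ∧ ε ≤ (p + 1 - q) / 2 generalizing ε
  · have h1 : min ε (min ((q - p) / 2) ((p + 1 - q) / 2)) ≤ ε := min_le_left _ _
    have h2 : min ε (min ((q - p) / 2) ((p + 1 - q) / 2)) ≤ (q - p) / 2 :=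
      (min_le_right _ _).trans (min_le_left _ _)
    have h3 : min ε (min ((q - p) / 2) ((p + 1 - q) / 2)) ≤ (p + 1 - q) / 2 :=
      (min_le_right _ _).trans (min_le_right _ _)
    rcases this (lt_min hε (lt_min (by linarith) (by linarith))) ⟨h2, h3⟩ with h | h
    · exact Or.inl h
    · obtain ⟨s, t, a1, a2, a3, a4, a5⟩ := h
      exact Or.inr ⟨s, t, a1, by linarith, by linarith, a4, a5⟩
  obtain ⟨hε1, hε2⟩ := hε4
  set N₁ : Set S1 := ((↑) : ℝ → S1) '' Ioo (p - ε) (p + ε)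
  set N₂ : Set S1 := ((↑) : ℝ → S1) '' Ioo (q - ε) (q + ε)
  have hN₁ : IsOpen N₁ := isOpen_coe_Ioo _ _
  have hN₂ : IsOpen N₂ := isOpen_coe_Ioo _ _
  have hpN : (p : S1) ∈ N₁ := mem_image_of_mem _ ⟨by linarith, by linarith⟩
  have hqN : (q : S1) ∈ N₂ := mem_image_of_mem _ ⟨by linarith, by linarith⟩
  set C : Set (S1 × S1) := (L.leaves ∪ diagonal S1) \ (N₁ ×ˢ N₂ ∪ N₂ ×ˢ N₁)
  have hCc : IsClosed C :=
    L.isClosed_leaves_union_diagonal.sdiff ((hN₁.prod hN₂).union (hN₂.prod hN₁))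
  set m : ℂ := (1 / 2 : ℝ) • pt p + (1 / 2 : ℝ) • pt q
  have hAB : pt p ≠ pt q := fun e => L.ne _ _ h (toPlane_injective e)
  have hm1 : ‖m‖ < 1 := combo_norm_lt (norm_pt _) (norm_pt _) hAB (by norm_num)
    (by norm_num) (by norm_num)
  have hm0 : cross (pt p) (pt q) m = 0 := by
    rw [cross_combo _ _ _ _ (by norm_num), cross_left, cross_right]; ring
  have hnot : m ∈ {w | ∃ a b : S1, (a, b) ∈ C ∧ w ∈ chord a b}ᶜ := by
    rintro ⟨a, b, ⟨hab, habN⟩, hw⟩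
    rcases hab with hab | hab
    · rcases eq_of_chords_meet hpq hqp h hab hm1 hm0 hw with ⟨rfl, rfl⟩ | ⟨rfl, rfl⟩
      · exact habN (Or.inl ⟨hpN, hqN⟩)
      · exact habN (Or.inr ⟨hqN, hpN⟩)
    · obtain rfl : a = b := hab
      rw [chord, segment_same, mem_singleton_iff] at hw
      rw [hw, norm_toPlane] at hm1
      exact lt_irrefl _ hm1
  -- the normal to the chord at its midpoint, towards the arc from `p` to `q`
  set w : ℝ → ℂ := fun τ => m + (-τ) • (Complex.I * (pt q - pt p))
  have hcont : Continuous w := by fun_prop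
  have hw0 : w 0 = m := by simp [w]
  have hwc : ∀ τ, 0 < τ → cross (pt p) (pt q) (w τ) < 0 := by
    intro τ hτ
    have : 0 < ‖pt q - pt p‖ ^ 2 := by
      have := norm_pos_iff.2 (sub_ne_zero.2 hAB.symm)
      positivity
    simp only [w]
    rw [cross_add_normal, hm0]
    nlinarith
  have hev : ∀ᶠ τ in 𝓝 (0 : ℝ), w τ ∈ {w | ∃ a b : S1, (a, b) ∈ C ∧ w ∈ chord a b}ᶜ ∩
      Metric.ball 0 1 := by
    apply hcont.continuousAt.eventually_mem
    rw [hw0]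
    exact ((isClosed_chords hCc).isOpen_compl.inter Metric.isOpen_ball).mem_nhds
      ⟨hnot, by simpa using hm1⟩
  obtain ⟨δ, hδ, hδ'⟩ := exists_Ico_subset_of_mem_nhds hev ⟨1, zero_lt_one⟩
  have hδ'' : ∀ τ ∈ Ioo 0 δ, _ := fun τ hτ => hδ' ⟨hτ.1.le, hτ.2⟩
  by_cases hex : ∃ τ ∈ Ioo 0 δ, w τ ∈ L.support
  · right
    obtain ⟨τ, hτ, a, b, hab, hw⟩ := hex
    have hCab : (a, b) ∉ C := fun h => (hδ'' τ hτ).1 ⟨a, b, h, hw⟩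
    have hN2 : (a, b) ∈ N₁ ×ˢ N₂ ∪ N₂ ×ˢ N₁ := by
      by_contra hcon
      exact hCab ⟨Or.inl hab, hcon⟩
    clear hCab
    wlog hN3 : (a, b) ∈ N₁ ×ˢ N₂ generalizing a b
    · exact this b a (L.symm _ _ hab) (by rwa [chord, segment_symm])
        (hN2.symm.imp (fun h => ⟨h.2, h.1⟩) (fun h => ⟨h.2, h.1⟩))
        ((hN2.resolve_left hN3).symm)
    obtain ⟨⟨s, hs, rfl⟩, t, ht, rfl⟩ := hN3
    obtain ⟨σ, σ', hσ, hσ', hσσ, hw⟩ := hw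
    have hneg := hwc τ hτ.1
    rw [← hw, cross_combo _ _ _ _ hσσ] at hneg
    have hcs : s ≤ p → 0 ≤ cross (pt p) (pt q) (toPlane s) := by
      intro hsp
      rcases eq_or_lt_of_le hsp with rfl | hsp
      · exact (cross_left _ _).ge
      · have := cross_pt_pos hpq (c := s + 1) (by linarith [hs.1]) (by linarith)
        rw [pt_add_one] at this
        exact this.le
    have hct : q ≤ t → 0 ≤ cross (pt p) (pt q) (toPlane t) := by
      intro hqt
      rcases eq_or_lt_of_le hqt with rfl | hqt
      · exact (cross_right _ _).ge
      · exact (cross_pt_pos hpq hqt (by linarith [ht.2])).le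
    have hor : p < s ∨ t < q := by
      by_contra hcon
      push Not at hcon
      nlinarith [hcs hcon.1, hct hcon.2, mul_nonneg hσ (hcs hcon.1), mul_nonneg hσ' (hct hcon.2)]
    refine ⟨s, t, ?_, hs.2, ht.1, ?_, hab, hor⟩
    · by_contra hsp
      push Not at hsp
      have htq : t < q := hor.resolve_left (by linarith)
      exact Rel.not_link h (rel_add_one_right.2 (Rel.symm hab)) (by linarith [ht.1]) htq
        (by linarith [hs.1]) (by linarith)
    · by_contra hqt
      push Not at hqt
      have hps : p < s := hor.resolve_right (by linarith)
      exact Rel.not_link h hab hps (by linarith [hs.2]) hqt (by linarith [ht.2])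
  · left
    push Not at hex
    obtain ⟨P, hP, hPI⟩ := exists_isGap_of_isPreconnected (L := L) (I := w '' Ioo 0 δ)
      (isPreconnected_Ioo.image _ hcont.continuousOn) ((nonempty_Ioo.2 hδ).image _) (by
        rintro _ ⟨r, hr, rfl⟩
        exact ⟨(hδ'' r hr).2, hex r hr⟩)
    have hmP : m ∈ P := by
      apply hPI
      have h1 : (0 : ℝ) ∈ closure (Ioo 0 δ) := by
        rw [closure_Ioo hδ.ne]; exact ⟨le_rfl, hδ.le⟩
      have := image_closure_subset_closure_image hcont (mem_image_of_mem _ h1)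
      rwa [hw0] at this
    have hside : ∀ x ∈ P, cross (pt p) (pt q) x ≤ 0 := by
      rcases cross_nonneg_or_nonpos_of_isGap h hP with h1 | h1
      · have h2 := h1 (w (δ / 2)) (hPI (subset_closure
          (mem_image_of_mem _ ⟨by linarith [hδ], by linarith [hδ]⟩)))
        have := hwc (δ / 2) (by linarith [hδ])
        exact absurd h2 (not_le.2 this)
      · exact h1
    obtain ⟨V, hV3, -, hPV, hV⟩ := hF.exists_vertices hP
    have hVcases : ∀ x ∈ V, (x = p ∨ x = q) ∨ ∃ t : ℝ, p < t ∧ t < q ∧ (t : S1) = x ∧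
        cross (pt p) (pt q) (toPlane x) < 0 := by
      intro x hx
      rcases cross_pt_cases hpq hqp x with hx1 | hx1 | ⟨t, -, -, -, hx1⟩
      · exact Or.inl hx1
      · exact Or.inr hx1
      · exact absurd (hside _ ((hV x).2 hx)) (not_le.2 hx1)
    have hpV : (p : S1) ∈ V := by
      by_contra hpV
      -- an open half-plane together with one point of its boundary line is convex
      have hconv : Convex ℝ {x : ℂ | cross (pt p) (pt q) x < 0 ∨ x = pt q} := by
        intro x hx y hy s t hs ht hst
        rcases eq_or_lt_of_le hs with rfl | hs
        · obtain rfl : t = 1 := by linarith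
          simpa using hy
        rcases eq_or_lt_of_le ht with rfl | ht
        · obtain rfl : s = 1 := by linarith
          simpa using hx
        simp only [mem_ofPred_eq, cross_combo _ _ _ _ hst]
        rcases hx with hx | rfl <;> rcases hy with hy | rfl
        · left; nlinarith
        · left; rw [cross_right]; nlinarith
        · left; rw [cross_right]; nlinarith
        · right; rw [← add_smul, hst, one_smul]
      rw [hPV] at hmP
      have := convexHull_min (by
        rintro _ ⟨x, hx, rfl⟩
        rcases hVcases x hx with (rfl | rfl) | ⟨-, -, -, -, hx1⟩
        · exact absurd hx hpV
        · exact Or.inr rfl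
        · exact Or.inl hx1) hconv hmP
      rcases this with h1 | h1
      · exact absurd hm0 h1.ne
      · rw [h1, norm_pt] at hm1
        exact lt_irrefl _ hm1
    obtain ⟨x, hx, hxpq⟩ : ∃ x ∈ V, x ∉ ({(p : S1), (q : S1)} : Finset S1) := by
      by_contra hcon
      push Not at hcon
      have := (Finset.card_le_card hcon).trans Finset.card_le_two
      omega
    rcases hVcases x hx with hx1 | ⟨u, hu1, hu2, rfl, -⟩
    · exact absurd (by simpa using hx1) hxpq
    · obtain ⟨v, hv1, hv2, -, hv⟩ := hF.exists_next_vertex hP ((hV p).2 hpV) ((hV _).2 hx) hu1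
        (by linarith)
      exact ⟨v, hv1, by linarith, hv⟩

end Lamination

/-! ### Iterating homeomorphisms of the line -/

lemma tendsto_iterate_of_lt {F : ℝ ≃o ℝ} {u y : ℝ} (hu : F u = u) (huy : u < y)
    (h : ∀ z, u < z → z ≤ y → F z < z) : Tendsto (fun n => F^[n] y) atTop (𝓝 u) := by
  have hmono : Antitone fun n => F^[n] y :=
    F.monotone.antitone_iterate_of_map_le (h y huy le_rfl).le
  have hge : ∀ n, u ≤ F^[n] y := by
    intro n
    induction n with
    | zero => exact huy.le
    | succ n ih =>
      rw [Function.iterate_succ_apply', ← hu]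
      exact F.monotone ih
  have hlim := tendsto_atTop_ciInf hmono ⟨u, by rintro _ ⟨n, rfl⟩; exact hge n⟩
  have hfix := isFixedPt_of_tendsto_iterate hlim F.continuous.continuousAt
  set l := ⨅ n, F^[n] y
  have hul : u ≤ l := ge_of_tendsto' hlim hge
  have hly : l ≤ y := le_of_tendsto' hlim fun n => hmono (Nat.zero_le n)
  rcases eq_or_lt_of_le hul with e | hlt
  · rwa [← e] at hlim
  · exact absurd hfix (h l hlt hly).ne

lemma tendsto_iterate_of_gt {F : ℝ ≃o ℝ} {v y : ℝ} (hv : F v = v) (hyv : y < v)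
    (h : ∀ z, y ≤ z → z < v → z < F z) : Tendsto (fun n => F^[n] y) atTop (𝓝 v) := by
  have hmono : Monotone fun n => F^[n] y :=
    F.monotone.monotone_iterate_of_le_map (h y le_rfl hyv).le
  have hge : ∀ n, F^[n] y ≤ v := by
    intro n
    induction n with
    | zero => exact hyv.le
    | succ n ih =>
      rw [Function.iterate_succ_apply', ← hv]
      exact F.monotone ih
  have hlim := tendsto_atTop_ciSup hmono ⟨v, by rintro _ ⟨n, rfl⟩; exact hge n⟩
  have hfix := isFixedPt_of_tendsto_iterate hlim F.continuous.continuousAt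
  set l := ⨆ n, F^[n] y
  have hul : l ≤ v := le_of_tendsto' hlim hge
  have hly : y ≤ l := ge_of_tendsto' hlim fun n => hmono (Nat.zero_le n)
  rcases eq_or_lt_of_le hul with e | hlt
  · rwa [e] at hlim
  · exact absurd hfix (h l hly hlt).ne'

lemma forall_lt_or_forall_gt {F : ℝ ≃o ℝ} {u v : ℝ} (h : ∀ w, u < w → w < v → F w ≠ w) :
    (∀ w, u < w → w < v → F w < w) ∨ (∀ w, u < w → w < v → w < F w) := by
  by_contra hcon
  push Not at hcon
  obtain ⟨⟨a, ha1, ha2, ha⟩, b, hb1, hb2, hb⟩ := hcon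
  have hcont : ContinuousOn (fun w => F w - w) (Ioo u v) :=
    (F.continuous.sub continuous_id).continuousOn
  have := isPreconnected_Ioo.intermediate_value (a := b) (b := a) ⟨hb1, hb2⟩ ⟨ha1, ha2⟩ hcont
  obtain ⟨c, hc, hc0⟩ := this (show (0 : ℝ) ∈ _ from ⟨by simpa using hb, by simpa using ha⟩)
  exact h c hc.1 hc.2 (by simpa [sub_eq_zero] using hc0)

lemma symm_ne_of_ne {F : ℝ ≃o ℝ} {w : ℝ} (h : F w ≠ w) : F.symm w ≠ w := fun e =>
  h (by conv_lhs => rw [← e, F.apply_symm_apply])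

lemma symm_fixed {F : ℝ ≃o ℝ} {w : ℝ} (h : F w = w) : F.symm w = w := by
  conv_lhs => rw [← h, F.symm_apply_apply]

/-- `x < y` are consecutive fixed points of `F`. -/
def Consecutive (F : ℝ ≃o ℝ) (x y : ℝ) : Prop :=
  x < y ∧ F x = x ∧ F y = y ∧ ∀ w, x < w → w < y → F w ≠ w

lemma Consecutive.symm {F : ℝ ≃o ℝ} {x y : ℝ} (h : Consecutive F x y) :
    Consecutive F.symm x y :=
  ⟨h.1, symm_fixed h.2.1, symm_fixed h.2.2.1, fun w h1 h2 => symm_ne_of_ne (h.2.2.2 w h1 h2)⟩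

/-- `x` is a fixed point of `F` that is not a limit of fixed points from the right. -/
def RightIsolated (F : ℝ ≃o ℝ) (x : ℝ) : Prop :=
  F x = x ∧ ∃ ε > 0, ∀ y, x < y → y < x + ε → F y ≠ y

lemma RightIsolated.exists_consecutive {F : ℝ ≃o ℝ} {x u : ℝ} (h : RightIsolated F x)
    (hxu : x < u) (hu : F u = u) : ∃ y, Consecutive F x y ∧ y ≤ u := by
  obtain ⟨hx, ε, hε, hfree⟩ := h
  set S : Set ℝ := {y | x + ε ≤ y ∧ F y = y}
  have hS : IsClosed S :=
    (isClosed_le continuous_const continuous_id).inter (isClosed_eq F.continuous continuous_id)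
  have huS : u ∈ S := ⟨by by_contra hc; exact hfree u hxu (not_le.1 hc) hu, hu⟩
  have hbdd : BddBelow S := ⟨x + ε, fun y hy => hy.1⟩
  have hmem := hS.csInf_mem ⟨u, huS⟩ hbdd
  refine ⟨sInf S, ⟨by linarith [hmem.1], hx, hmem.2, ?_⟩, csInf_le hbdd huS⟩
  intro w h1 h2 hw
  have : w ∈ S := ⟨by by_contra hc; exact hfree w h1 (not_le.1 hc) hw, hw⟩
  exact absurd (csInf_le hbdd this) (not_le.2 h2)

lemma exists_rightIsolated {F : ℝ ≃o ℝ} (hc : {x | F x = x}.Countable)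
    (hne : {x | F x = x}.Nonempty) : ∃ x, RightIsolated F x := by
  by_contra hcon
  push Not at hcon
  have hperf : Perfect {x | F x = x} := by
    refine ⟨isClosed_eq F.continuous continuous_id, preperfect_iff_nhds.2 ?_⟩
    intro x hx U hU
    obtain ⟨ε, hε, hball⟩ := Metric.mem_nhds_iff.1 hU
    by_contra hno
    push Not at hno
    refine hcon x ⟨hx, ε, hε, fun y h1 h2 hy => ?_⟩
    refine h1.ne' (hno y ⟨hball ?_, hy⟩)
    rw [Metric.mem_ball, Real.dist_eq, abs_of_pos (by linarith)]
    linarith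
  obtain ⟨f, hf, -, hinj⟩ := hperf.exists_nat_bool_injection hne
  have h1 : (range f).Countable := hc.mono hf
  have h2 : (univ : Set (ℕ → Bool)).Countable :=
    MapsTo.countable_of_injOn (f := f) (t := range f) (fun x _ => mem_range_self x)
      hinj.injOn h1
  have h3 : Countable (ℕ → Bool) := Set.countable_univ_iff.1 h2
  have h4 := Cardinal.mk_le_aleph0_iff.2 h3
  simp only [Cardinal.mk_pi, Cardinal.prod_const, Cardinal.mk_fintype, Fintype.card_bool,
    Cardinal.mk_nat, Cardinal.lift_id] at h4
  exact absurd h4 (not_le.2 (by simpa using Cardinal.cantor Cardinal.aleph0))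

/-! ### Dynamics near fixed points -/

namespace Lamination

variable {L : Lamination}

/-- The homeomorphism `F` of the line preserves the lifted lamination. -/
def Preserves (L : Lamination) (F : ℝ ≃o ℝ) : Prop := ∀ s t, L.Rel (F s) (F t) ↔ L.Rel s t

lemma Preserves.symm {F : ℝ ≃o ℝ} (h : L.Preserves F) : L.Preserves F.symm := fun s t => by
  rw [← h, F.apply_symm_apply, F.apply_symm_apply]

lemma Preserves.iterate {F : ℝ ≃o ℝ} (h : L.Preserves F) {s t : ℝ} (hst : L.Rel s t) (n : ℕ) :
    L.Rel (F^[n] s) (F^[n] t) := by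
  induction n with
  | zero => exact hst
  | succ n ih =>
    rw [Function.iterate_succ_apply', Function.iterate_succ_apply', h]
    exact ih

/-- A fixed point that attracts from the left and is not an endpoint of a leaf attracts from the
right: the images of a short leaf around the point cannot cross this leaf, and they cannot converge
to a leaf that ends at the point. -/
lemma Preserves.attracts_right (hL : L.IsVeryFull) {F : ℝ ≃o ℝ} (hF : L.Preserves F) {x ε : ℝ}
    (hx : F x = x) (hend : ∀ t, ¬ L.Rel x t) (hε : 0 < ε)
    (h : ∀ y, x - ε < y → y < x → y < F y) :
    ∃ δ > 0, ∀ y, x < y → y < x + δ → F y < y := by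
  have hd : 0 < F.symm (x + 1 / 2) - x := by
    rw [sub_pos, F.lt_symm_apply, hx]; linarith
  obtain ⟨a, b, h1, h2, h3, h4, hab⟩ := hL.exists_short_leaf hend
    (lt_min hε (lt_min (by norm_num : (0 : ℝ) < 1 / 2) hd))
  have m1 := min_le_left ε (min (1 / 2) (F.symm (x + 1 / 2) - x))
  have m2 := (min_le_right ε (min (1 / 2) (F.symm (x + 1 / 2) - x))).trans (min_le_left _ _)
  have m3 := (min_le_right ε (min (1 / 2) (F.symm (x + 1 / 2) - x))).trans (min_le_right _ _)
  have ha : a < F a := h a (by linarith) h2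
  have hax : F a < x := by rw [← hx]; exact F.strictMono h2
  have hb' : F b < x + 1 / 2 := by
    rw [← F.lt_symm_apply]; linarith
  have hb : F b ≤ b := by
    by_contra hcon
    push Not at hcon
    exact Rel.not_link hab ((hF a b).2 hab) ha (hax.trans h3) hcon (by linarith)
  have hlima : Tendsto (fun n => F^[n] a) atTop (𝓝 x) :=
    tendsto_iterate_of_gt hx h2 fun z hz hzx => h z (by linarith) hzx
  have hanti : Antitone fun n => F^[n] b := F.monotone.antitone_iterate_of_map_le hb
  have hnofix : ∀ z, x < z → z ≤ b → F z ≠ z := by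
    intro z hz hzb hfz
    have hge : ∀ n, z ≤ F^[n] b := by
      intro n
      induction n with
      | zero => exact hzb
      | succ n ih =>
        rw [Function.iterate_succ_apply', ← hfz]
        exact F.monotone ih
    have hlim := tendsto_atTop_ciInf hanti ⟨z, by rintro _ ⟨n, rfl⟩; exact hge n⟩
    have hzl := ge_of_tendsto' hlim hge
    have hlb := le_of_tendsto' hlim fun n => hanti (Nat.zero_le n)
    simp only [Function.iterate_zero, id] at hlb
    exact hend _ (rel_of_tendsto hlima hlim (fun n => hF.iterate hab n) (by linarith)
      (by linarith))
  have hb0 : F b < b := lt_of_le_of_ne hb (hnofix b h3 le_rfl)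
  refine ⟨b - x, by linarith, ?_⟩
  rcases forall_lt_or_forall_gt fun w h1 h2 => hnofix w h1 (le_of_lt h2) with h5 | h5
  · exact fun y hy1 hy2 => h5 y hy1 (by linarith)
  · have hFb : x < F b := by rw [← hx]; exact F.strictMono h3
    exact absurd (F.strictMono hb0) (h5 _ hFb hb0).not_gt

/-- Across a fixed point that is isolated from the left and not an endpoint of a leaf, the
direction in which points move is reversed. -/
lemma Preserves.reverses (hL : L.IsVeryFull) {F : ℝ ≃o ℝ} (hF : L.Preserves F) {x y : ℝ}
    (hxy : Consecutive F x y) (hend : ∀ t, ¬ L.Rel y t) :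
    ((∀ w, x < w → w < y → w < F w) ∧ ∃ δ > 0, ∀ w, y < w → w < y + δ → F w < w) ∨
    ((∀ w, x < w → w < y → F w < w) ∧ ∃ δ > 0, ∀ w, y < w → w < y + δ → w < F w) := by
  obtain ⟨hlt, hx, hy, hfree⟩ := hxy
  rcases forall_lt_or_forall_gt hfree with h | h
  · right
    refine ⟨h, ?_⟩
    obtain ⟨δ, hδ, h'⟩ := hF.symm.attracts_right hL (ε := y - x) (symm_fixed hy) hend
      (by linarith) (fun w h1 h2 => by
        rw [OrderIso.lt_symm_apply]
        exact h w (by linarith) h2)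
    exact ⟨δ, hδ, fun w h1 h2 => by
      have := h' w h1 h2
      rwa [OrderIso.symm_apply_lt] at this⟩
  · left
    exact ⟨h, hF.attracts_right hL (ε := y - x) hy hend (by linarith)
      fun w h1 h2 => h w (by linarith) h2⟩

lemma Preserves.rightIsolated (hL : L.IsVeryFull) {F : ℝ ≃o ℝ} (hF : L.Preserves F) {x y : ℝ}
    (hxy : Consecutive F x y) (hend : ∀ t, ¬ L.Rel y t) : RightIsolated F y := by
  refine ⟨hxy.2.2.1, ?_⟩
  rcases hF.reverses hL hxy hend with ⟨-, δ, hδ, h⟩ | ⟨-, δ, hδ, h⟩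
  · exact ⟨δ, hδ, fun w h1 h2 => (h w h1 h2).ne⟩
  · exact ⟨δ, hδ, fun w h1 h2 => (h w h1 h2).ne'⟩

lemma Preserves.opposite_signs (hL : L.IsVeryFull) {F : ℝ ≃o ℝ} (hF : L.Preserves F) {x y z : ℝ}
    (hxy : Consecutive F x y) (hyz : Consecutive F y z) (hend : ∀ t, ¬ L.Rel y t) :
    ((∀ w, x < w → w < y → w < F w) ∧ ∀ w, y < w → w < z → F w < w) ∨
    ((∀ w, x < w → w < y → F w < w) ∧ ∀ w, y < w → w < z → w < F w) := by
  have hlt := hyz.1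
  refine (hF.reverses hL hxy hend).imp ?_ ?_ <;> rintro ⟨h, δ, hδ, h'⟩ <;> refine ⟨h, ?_⟩
  all_goals
    have hw1 : y < min (y + δ / 2) ((y + z) / 2) := lt_min (by linarith) (by linarith)
    have hw2 := min_le_left (y + δ / 2) ((y + z) / 2)
    have hw3 := min_le_right (y + δ / 2) ((y + z) / 2)
    have h'' := h' _ hw1 (by linarith)
    rcases forall_lt_or_forall_gt hyz.2.2.2 with h0 | h0
    · first
      | exact h0
      | exact absurd (h0 _ hw1 (by linarith)) h''.not_gt
    · first
      | exact h0
      | exact absurd (h0 _ hw1 (by linarith)) h''.not_gt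

/-- The neighbours of a fixed point that is not an endpoint of a leaf are joined by a leaf: the
images of a short leaf around the point, under expanding powers, converge to it. -/
lemma Preserves.rel_of_consecutive (hL : L.IsVeryFull) {F : ℝ ≃o ℝ} (hF : L.Preserves F)
    {x y z : ℝ} (hxy : Consecutive F x y) (hyz : Consecutive F y z) (hzx : z < x + 1)
    (hend : ∀ t, ¬ L.Rel y t) : L.Rel x z := by
  have hlt := hxy.1
  have hlt' := hyz.1
  wlog h : (∀ w, x < w → w < y → F w < w) ∧ ∀ w, y < w → w < z → w < F w generalizing F
  · refine this hF.symm hxy.symm hyz.symm ?_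
    obtain ⟨h1, h2⟩ := (hF.opposite_signs hL hxy hyz hend).resolve_right h
    exact ⟨fun w hw hw' => by rw [OrderIso.symm_apply_lt]; exact h1 w hw hw',
      fun w hw hw' => by rw [OrderIso.lt_symm_apply]; exact h2 w hw hw'⟩
  obtain ⟨a, b, h1, h2, h3, h4, hab⟩ := hL.exists_short_leaf hend
    (lt_min (sub_pos.2 hlt) (sub_pos.2 hlt'))
  have m1 := min_le_left (y - x) (z - y)
  have m2 := min_le_right (y - x) (z - y)
  refine rel_of_tendsto
    (tendsto_iterate_of_lt hxy.2.1 (show x < a by linarith) fun w hw hw' => h.1 w hw (by linarith))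
    (tendsto_iterate_of_gt hyz.2.2.1 (show b < z by linarith)
      fun w hw hw' => h.2 w (by linarith) hw')
    (fun n => hF.iterate hab n) (by linarith) hzx

/-! ### Fixed points are isolated -/

lemma apply_add_int {F : ℝ ≃o ℝ} (hper : ∀ x, F (x + 1) = F x + 1) (x : ℝ) (k : ℤ) :
    F (x + k) = F x + k := by
  induction k using Int.induction_on with
  | zero => simp
  | succ i ih => push_cast at ih ⊢; rw [← add_assoc, hper, ih]; ring
  | pred i ih =>
    push_cast at ih ⊢
    have := hper (x + (-(i : ℝ) - 1))
    rw [show x + (-(i : ℝ) - 1) + 1 = x + -(i : ℝ) by ring, ih] at this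
    linarith

/-- If a fixed point were a limit of fixed points from the right, then going to the right from an
isolated fixed point would yield infinitely many consecutive fixed points within one period.
The leaves joining every second one of them would form an infinite chain. -/
lemma rightIsolated_of_fixed {L₁ L₂ : Lamination} (hV₁ : L₁.IsVeryFull) (hV₂ : L₂.IsVeryFull)
    (hL₁ : L₁.IsLoose) (hL₂ : L₂.IsLoose) (hdisj : ∀ x s t, L₁.Rel x s → ¬ L₂.Rel x t)
    {F : ℝ ≃o ℝ} (hF₁ : L₁.Preserves F) (hF₂ : L₂.Preserves F)
    (hper : ∀ x, F (x + 1) = F x + 1) (hc : {x | F x = x}.Countable) {y : ℝ} (hy : F y = y) :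
    RightIsolated F y := by
  by_contra hny
  obtain ⟨x₀, hx₀⟩ := exists_rightIsolated hc ⟨y, hy⟩
  have hfix : ∀ k : ℤ, F (y + k) = y + k := fun k => by rw [apply_add_int hper, hy]
  have hnk : ∀ k : ℤ, ¬ RightIsolated F (y + k) := by
    rintro k ⟨-, ε, hε, h⟩
    refine hny ⟨hy, ε, hε, fun w h1 h2 hw => h (w + k) (by linarith) (by linarith) ?_⟩
    rw [apply_add_int hper, hw]
  obtain ⟨y', hy'1, hy'2, hy'3, hy'4⟩ :
      ∃ y', x₀ < y' ∧ y' ≤ x₀ + 1 ∧ F y' = y' ∧ ¬ RightIsolated F y' := by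
    refine ⟨y + (⌊x₀ - y⌋ + 1 : ℤ), ?_, ?_, hfix _, hnk _⟩
    · push_cast; linarith [Int.lt_floor_add_one (x₀ - y)]
    · push_cast; linarith [Int.floor_le (x₀ - y)]
  have hnext : ∀ x, RightIsolated F x ∧ x < y' →
      ∃ x', (RightIsolated F x' ∧ x' < y') ∧ Consecutive F x x' := by
    rintro x ⟨hx, hxy⟩
    obtain ⟨x', hx', hx'y⟩ := hx.exists_consecutive hxy hy'3
    have hri : RightIsolated F x' := by
      by_cases h : ∀ t, ¬ L₁.Rel x' t
      · exact hF₁.rightIsolated hV₁ hx' h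
      · push Not at h
        obtain ⟨s, hs⟩ := h
        exact hF₂.rightIsolated hV₂ hx' fun t => hdisj x' s t hs
    exact ⟨x', ⟨hri, lt_of_le_of_ne hx'y (fun e => hy'4 (e ▸ hri))⟩, hx'⟩
  choose! nx hnx hnxc using hnext
  set x : ℕ → ℝ := fun n => nx^[n] x₀
  have hxP : ∀ n, RightIsolated F (x n) ∧ x n < y' := by
    intro n
    induction n with
    | zero => exact ⟨hx₀, hy'1⟩
    | succ n ih =>
      simp only [x, Function.iterate_succ_apply']
      exact hnx _ ih
  have hxc : ∀ n, Consecutive F (x n) (x (n + 1)) := by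
    intro n
    simp only [x, Function.iterate_succ_apply']
    exact hnxc _ (hxP n)
  have hmono : StrictMono x := strictMono_nat_of_lt_succ fun n => (hxc n).1
  have hbd : ∀ m n, x m < x n + 1 := fun m n => by
    have h1 := hmono.monotone (Nat.zero_le n)
    have h2 := (hxP m).2
    simp only [x, Function.iterate_zero, id] at h1 h2 ⊢
    linarith
  -- the points with even index form a chain of leaves of the lamination `M` for which `x 1` is not
  -- an endpoint, those with odd index a chain of leaves of the other one
  have main : ∀ {M N : Lamination}, M.IsVeryFull → N.IsVeryFull → M.IsLoose →
      (∀ x s t, M.Rel x s → ¬ N.Rel x t) → M.Preserves F → N.Preserves F →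
      (∀ t, ¬ M.Rel (x 1) t) → False := by
    intro M N hM hN hML hMN hFM hFN h1
    have hind : ∀ n, M.Rel (x (2 * n)) (x (2 * n + 2)) := by
      intro n
      induction n with
      | zero => exact hFM.rel_of_consecutive hM (hxc 0) (hxc 1) (hbd _ _) h1
      | succ n ih =>
        have e1 : N.Rel (x (2 * n + 1)) (x (2 * n + 3)) :=
          hFN.rel_of_consecutive hN (hxc _) (hxc _) (hbd _ _) fun t => hMN _ _ t (Rel.symm ih)
        exact hFM.rel_of_consecutive hM (hxc _) (hxc _) (hbd _ _)
          fun t ht => hMN _ _ _ ht (Rel.symm e1)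
    exact not_chain hM hML (y := fun n => x (2 * n)) (fun m n h => hmono (by omega))
      (fun n => hbd _ _) hind
  by_cases h : ∀ t, ¬ L₁.Rel (x 1) t
  · exact main hV₁ hV₂ hL₁ hdisj hF₁ hF₂ h
  · push Not at h
    obtain ⟨s, hs⟩ := h
    exact main hV₂ hV₁ hL₂ (fun x s t h h' => hdisj x t s h' h) hF₂ hF₁ fun t => hdisj _ s t hs

end Lamination

/-! ### Hölder's theorem -/

/-- Hölder's theorem: an Archimedean bi-ordered group is commutative. If `y * x < x * y`, then the
quotient `c` of the two sides is less than `e * e` for every `e > 1`, because `x` and `y` are known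
up to a factor `e`; so `c` is the least element above `1` and generates the group. -/
theorem mul_comm_of_archimedean_order {G : Type*} [Group G] [LinearOrder G] [MulLeftMono G]
    [MulRightMono G] (arch : ∀ a b : G, 1 < a → ∃ n : ℕ, b < a ^ n) (x y : G) :
    x * y = y * x := by
  wlog hxy : y * x < x * y generalizing x y
  · by_contra hne
    exact hne (this y x (lt_of_le_of_ne (not_lt.1 hxy) hne)).symm
  exfalso
  have near : ∀ e z : G, 1 < e → ∃ m : ℤ, e ^ m ≤ z ∧ z < e ^ m * e := by
    intro e z he
    obtain ⟨n, hn⟩ := arch e z he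
    obtain ⟨k, hk⟩ := arch e z⁻¹ he
    have hmono : StrictMono fun m : ℤ => e ^ m :=
      strictMono_int_of_lt_succ fun m => by
        rw [zpow_add_one]; exact lt_mul_of_one_lt_right' _ he
    obtain ⟨m, hm, hmax⟩ := Int.exists_greatest_of_bdd (P := fun m => e ^ m ≤ z)
      ⟨n, fun m hm => by
        by_contra hcon
        push Not at hcon
        have := hmono hcon
        simp only [zpow_natCast] at this
        exact absurd (hm.trans_lt hn) this.not_gt⟩
      ⟨-k, by
        rw [zpow_neg, zpow_natCast]
        exact (inv_lt_of_inv_lt' hk).le⟩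
    refine ⟨m, hm, ?_⟩
    by_contra hcon
    rw [← zpow_add_one] at hcon
    have := hmax _ (not_lt.1 hcon)
    omega
  set c := (y * x)⁻¹ * (x * y)
  have hc : 1 < c := by
    rw [← inv_mul_cancel (y * x)]
    exact mul_lt_mul_right hxy _
  have hsq : ∀ e : G, 1 < e → c < e * e := by
    intro e he
    obtain ⟨m, hm1, hm2⟩ := near e x he
    obtain ⟨n, hn1, hn2⟩ := near e y he
    have h1 : e ^ (n + m) ≤ y * x := by rw [zpow_add]; exact mul_le_mul' hn1 hm1
    have h2 : x * y < e ^ (n + m) * (e * e) := by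
      have := mul_lt_mul_of_lt_of_lt hm2 hn2
      calc x * y < e ^ m * e * (e ^ n * e) := this
        _ = e ^ (n + m) * (e * e) := by
          rw [← zpow_add_one, ← zpow_add_one, ← zpow_add, ← pow_two, ← zpow_natCast, ← zpow_add]
          congr 1
          push_cast
          ring
    calc c ≤ (e ^ (n + m))⁻¹ * (x * y) := mul_le_mul_left (inv_le_inv_iff.2 h1) _
      _ < (e ^ (n + m))⁻¹ * (e ^ (n + m) * (e * e)) := mul_lt_mul_right h2 _
      _ = e * e := inv_mul_cancel_left _ _
  have hmin : ∀ d : G, 1 < d → c ≤ d := by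
    intro d hd
    by_contra hcon
    push Not at hcon
    have hdc : 1 < d⁻¹ * c := by
      rw [← inv_mul_cancel d]
      exact mul_lt_mul_right hcon _
    have h1 := hsq _ (lt_min hd hdc)
    have h2 : min d (d⁻¹ * c) * min d (d⁻¹ * c) ≤ d * (d⁻¹ * c) :=
      mul_le_mul' (min_le_left _ _) (min_le_right _ _)
    rw [mul_inv_cancel_left] at h2
    exact absurd h1 h2.not_gt
  have hgen : ∀ z : G, ∃ m : ℤ, z = c ^ m := by
    intro z
    obtain ⟨m, hm1, hm2⟩ := near c z hc
    refine ⟨m, ?_⟩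
    by_contra hne
    have h1 : 1 < (c ^ m)⁻¹ * z := by
      rw [← inv_mul_cancel (c ^ m)]
      exact mul_lt_mul_right (lt_of_le_of_ne hm1 (Ne.symm hne)) _
    have h2 := mul_le_mul_right (hmin _ h1) (c ^ m)
    rw [mul_inv_cancel_left] at h2
    exact absurd hm2 h2.not_gt
  obtain ⟨m, hm⟩ := hgen x
  obtain ⟨n, hn⟩ := hgen y
  clear_value c
  rw [hm, hn, ← zpow_add, ← zpow_add, add_comm] at hxy
  exact lt_irrefl _ hxy

/-- Hölder's theorem in terms of the positive cone `E` of a bi-invariant order. -/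
theorem mul_comm_of_archimedean_cone {G : Type*} [Group G] (E : Set G) (h1 : (1 : G) ∉ E)
    (hmul : ∀ a ∈ E, ∀ b ∈ E, a * b ∈ E) (htri : ∀ a, a = 1 ∨ a ∈ E ∨ a⁻¹ ∈ E)
    (hconj : ∀ a ∈ E, ∀ k, k * a * k⁻¹ ∈ E) (harch : ∀ a ∈ E, ∀ b ∈ E, ∃ n : ℕ, b⁻¹ * a ^ n ∈ E)
    (x y : G) : x * y = y * x := by
  let lin : LinearOrder G :=
    { le := fun a b => a = b ∨ a⁻¹ * b ∈ E
      le_refl := fun a => Or.inl rfl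
      le_trans := by
        intro a b c hab hbc
        rcases hab with hab | hab <;> rcases hbc with hbc | hbc
        · exact Or.inl (hab.trans hbc)
        · rw [hab]; exact Or.inr hbc
        · rw [← hbc]; exact Or.inr hab
        · right
          have := hmul _ hab _ hbc
          rwa [mul_assoc, mul_inv_cancel_left] at this
      le_antisymm := by
        intro a b hab hba
        rcases hab with hab | hab
        · exact hab
        rcases hba with h | hba
        · exact h.symm
        · have := hmul _ hab _ hba
          rw [mul_assoc, mul_inv_cancel_left, inv_mul_cancel] at this
          exact absurd this h1
      le_total := by
        intro a b
        rcases htri (a⁻¹ * b) with h | h | h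
        · exact Or.inl (Or.inl (inv_mul_eq_one.1 h))
        · exact Or.inl (Or.inr h)
        · rw [mul_inv_rev, inv_inv] at h
          exact Or.inr (Or.inr h)
      toDecidableLE := Classical.decRel _ }
  have hlt : ∀ a b : G, a < b ↔ a⁻¹ * b ∈ E := by
    intro a b
    rw [lt_iff_le_and_ne]
    constructor
    · rintro ⟨rfl | h, hne⟩
      · exact absurd rfl hne
      · exact h
    · intro h
      refine ⟨Or.inr h, ?_⟩
      rintro rfl
      rw [inv_mul_cancel] at h
      exact h1 h
  have il : MulLeftMono G := ⟨fun k a b hab => by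
    rcases hab with rfl | h
    · exact le_rfl
    · refine Or.inr ?_
      rwa [mul_inv_rev, mul_assoc, inv_mul_cancel_left]⟩
  have ir : MulRightMono G := ⟨fun k a b hab => by
    rcases hab with rfl | h
    · exact le_rfl
    · refine Or.inr ?_
      have := hconj _ h k⁻¹
      simp only [Function.swap, mul_inv_rev]
      simpa [mul_assoc] using this⟩
  refine mul_comm_of_archimedean_order (fun a b ha => ?_) x y
  have haE : a ∈ E := by simpa using (hlt _ _).1 ha
  rcases htri b with rfl | hb | hb
  · exact ⟨1, by rwa [pow_one]⟩
  · obtain ⟨n, hn⟩ := harch a haE b hb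
    exact ⟨n, (hlt _ _).2 hn⟩
  · exact ⟨0, by rw [pow_zero, hlt, mul_one]; exact hb⟩

/-! ### Groups acting on an interval with one fixed point per element -/

lemma pow_apply (F : ℝ ≃o ℝ) (n : ℕ) (x : ℝ) : (F ^ n) x = F^[n] x := by
  induction n with
  | zero => rfl
  | succ n ih => rw [pow_succ', Function.iterate_succ_apply', ← ih]; rfl

/-- `F` has exactly one fixed point in `(p, q)`, and either moves all other points of the interval
away from it or moves all of them towards it. -/
def HasUniqueCrossing (F : ℝ ≃o ℝ) (p q : ℝ) : Prop :=
  ∃ c, p < c ∧ c < q ∧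
    (((∀ w, p < w → w < c → F w < w) ∧ ∀ w, c < w → w < q → w < F w) ∨
      ((∀ w, p < w → w < c → w < F w) ∧ ∀ w, c < w → w < q → F w < w))

/-- A group whose nontrivial elements all have a unique crossing in `(p, q)` is commutative. The
elements that expand from their fixed point form the positive cone of a bi-invariant order. It is
Archimedean: if `b⁻¹ * a ^ n` were never positive, its fixed point would, for large `n`, have to lie
on both sides of the fixed point of `a`. -/
theorem commute_of_hasUniqueCrossing {Γ : Subgroup (ℝ ≃o ℝ)} {p q : ℝ}
    (hp : ∀ F ∈ Γ, F p = p) (hq : ∀ F ∈ Γ, F q = q)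
    (h : ∀ F ∈ Γ, F ≠ 1 → HasUniqueCrossing F p q) {F H : ℝ ≃o ℝ} (hF : F ∈ Γ) (hH : H ∈ Γ) :
    F * H = H * F := by
  let E : Set Γ := {K | ∃ y₀, p < y₀ ∧ ∀ y, p < y → y < y₀ → (K : ℝ ≃o ℝ) y < y}
  have gt_p : ∀ K : Γ, ∀ y, p < y → p < (K : ℝ ≃o ℝ) y := fun K y hy => by
    have := (K : ℝ ≃o ℝ).strictMono hy
    rwa [hp _ K.2] at this
  have lt_q : ∀ K : Γ, ∀ y, y < q → (K : ℝ ≃o ℝ) y < q := fun K y hy => by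
    have := (K : ℝ ≃o ℝ).strictMono hy
    rwa [hq _ K.2] at this
  have hne : ∀ K : Γ, K ≠ 1 → HasUniqueCrossing (K : ℝ ≃o ℝ) p q := fun K hK =>
    h K K.2 (fun e => hK (Subtype.ext e))
  have hE1 : (1 : Γ) ∉ E := by
    rintro ⟨y₀, h0, hy⟩
    exact lt_irrefl _ (hy ((p + y₀) / 2) (by linarith) (by linarith))
  have hEE : ∀ K : Γ, K ∈ E → ∃ c, p < c ∧ c < q ∧
      (∀ w, p < w → w < c → (K : ℝ ≃o ℝ) w < w) ∧ ∀ w, c < w → w < q → w < (K : ℝ ≃o ℝ) w := by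
    rintro K hK
    obtain ⟨c, hc1, hc2, h | h⟩ := hne K (by rintro rfl; exact hE1 hK)
    · exact ⟨c, hc1, hc2, h⟩
    · exfalso
      obtain ⟨y₀, h0, hy⟩ := hK
      have m1 := min_le_left y₀ c
      have m2 := min_le_right y₀ c
      have m3 : p < min y₀ c := lt_min h0 hc1
      exact lt_asymm (h.1 ((p + min y₀ c) / 2) (by linarith) (by linarith))
        (hy ((p + min y₀ c) / 2) (by linarith) (by linarith))
  have key : ∀ a b : Γ, a * b = b * a := by
    refine mul_comm_of_archimedean_cone E hE1 ?_ ?_ ?_ ?_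
    · rintro a ⟨y₀, h0, ha⟩ b ⟨y₁, h1, hb⟩
      refine ⟨min y₀ y₁, lt_min h0 h1, fun y hy hy' => ?_⟩
      have hb' := hb y hy (hy'.trans_le (min_le_right _ _))
      exact (ha _ (gt_p b y hy) (hb'.trans (hy'.trans_le (min_le_left _ _)))).trans hb'
    · intro a
      by_cases ha : a = 1
      · exact Or.inl ha
      right
      obtain ⟨c, hc1, hc2, h | h⟩ := hne a ha
      · exact Or.inl ⟨c, hc1, h.1⟩
      · exact Or.inr ⟨c, hc1, fun y hy hy' => (OrderIso.symm_apply_lt _).2 (h.1 y hy hy')⟩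
    · rintro a ⟨y₀, h0, ha⟩ k
      refine ⟨(k : ℝ ≃o ℝ) y₀, gt_p k _ h0, fun y hy hy' => ?_⟩
      have h2 := ha _ (gt_p k⁻¹ y hy) ((OrderIso.symm_apply_lt (k : ℝ ≃o ℝ)).2 hy')
      exact (OrderIso.lt_symm_apply (k : ℝ ≃o ℝ)).1 h2
    · intro a ha b hb
      by_contra hcon
      push Not at hcon
      have hn1 : ∀ n : ℕ, b⁻¹ * a ^ n ≠ 1 := by
        intro n hn
        apply hcon (n + 1)
        rwa [pow_succ, ← mul_assoc, hn, one_mul]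
      obtain ⟨c, hc1, hc2, ha1, ha2⟩ := hEE a ha
      have l1 : Tendsto (fun n => (a : ℝ ≃o ℝ)^[n] ((p + c) / 2)) atTop (𝓝 p) :=
        tendsto_iterate_of_lt (hp _ a.2) (by linarith) fun z hz hz' => ha1 z hz (by linarith)
      have l2 : Tendsto (fun n => (a : ℝ ≃o ℝ)^[n] ((c + q) / 2)) atTop (𝓝 q) :=
        tendsto_iterate_of_gt (hq _ a.2) (by linarith) fun z hz hz' => ha2 z (by linarith) hz'
      have e1 := l1.eventually (gt_mem_nhds (gt_p b ((p + c) / 2) (by linarith)))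
      have e2 := l2.eventually (lt_mem_nhds (lt_q b ((c + q) / 2) (by linarith)))
      obtain ⟨n, hn1', hn2'⟩ := (e1.and e2).exists
      have k1 : ((b⁻¹ * a ^ n : Γ) : ℝ ≃o ℝ) ((p + c) / 2) < (p + c) / 2 := by
        refine (OrderIso.symm_apply_lt (b : ℝ ≃o ℝ)).2 ?_
        change ((a : ℝ ≃o ℝ) ^ n) _ < _
        rwa [pow_apply]
      have k2 : (c + q) / 2 < ((b⁻¹ * a ^ n : Γ) : ℝ ≃o ℝ) ((c + q) / 2) := by
        refine (OrderIso.lt_symm_apply (b : ℝ ≃o ℝ)).2 ?_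
        change _ < ((a : ℝ ≃o ℝ) ^ n) _
        rwa [pow_apply]
      obtain ⟨d, hd1, hd2, hd | hd⟩ := hne _ (hn1 n)
      · exact hcon n ⟨d, hd1, hd.1⟩
      · have g1 : d ≤ (p + c) / 2 := by
          by_contra hlt
          exact lt_asymm k1 (hd.1 _ (by linarith) (not_le.1 hlt))
        have g2 : (c + q) / 2 ≤ d := by
          by_contra hlt
          exact lt_asymm k2 (hd.2 _ (not_le.1 hlt) (by linarith))
        linarith
  exact congrArg Subtype.val (key ⟨F, hF⟩ ⟨H, hH⟩)

/-- If `H` commutes with `F` and has fixed points in all periods, then it fixes the fixed points of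
`F`, provided these are isolated from the right: otherwise the orbits of `H` in the set of fixed
points of `F` would accumulate there from the right. -/
lemma fixed_of_commute {F H : ℝ ≃o ℝ} (hFH : F * H = H * F) {p x : ℝ}
    (hH : ∀ k : ℤ, H (p + k) = p + k) (hiso : ∀ y, F y = y → RightIsolated F y) (hx : F x = x) :
    H x = x := by
  by_contra hne
  wlog hlt : H x < x generalizing H
  · have hgt : x < H x := lt_of_le_of_ne (not_lt.1 hlt) (Ne.symm hne)
    have hlt' : H.symm x < x := H.symm_apply_lt.2 hgt
    refine this (H := H⁻¹) ?_ (fun k => symm_fixed (hH k)) hlt'.ne hlt'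
    rw [eq_inv_mul_iff_mul_eq, ← mul_assoc, ← hFH, mul_assoc, mul_inv_cancel, mul_one]
  have hanti : StrictAnti fun n => H^[n] x := H.strictMono.strictAnti_iterate_of_map_lt hlt
  have hge : ∀ n, p + ⌊x - p⌋ ≤ H^[n] x := by
    intro n
    induction n with
    | zero => simp only [Function.iterate_zero, id]; linarith [Int.floor_le (x - p)]
    | succ n ih =>
      rw [Function.iterate_succ_apply', ← hH]
      exact H.monotone ih
  have hfix : ∀ n, F (H^[n] x) = H^[n] x := by
    intro n
    induction n with
    | zero => exact hx
    | succ n ih =>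
      rw [Function.iterate_succ_apply']
      have := congrArg (fun K : ℝ ≃o ℝ => K (H^[n] x)) hFH
      change F (H _) = H (F _) at this
      rw [this, ih]
  have hlim := tendsto_atTop_ciInf hanti.antitone ⟨_, by rintro _ ⟨n, rfl⟩; exact hge n⟩
  set l := ⨅ n, H^[n] x
  have hl : F l = l := by
    refine tendsto_nhds_unique ((F.continuous.tendsto l).comp hlim) ?_
    simpa only [Function.comp_def, hfix] using hlim
  obtain ⟨-, ε, hε, hfree⟩ := hiso l hl
  obtain ⟨n, hn⟩ := (hlim.eventually (gt_mem_nhds (show l < l + ε by linarith))).exists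
  have hle : l ≤ H^[n + 1] x := hanti.antitone.le_of_tendsto hlim (n + 1)
  exact hfree _ (hle.trans_lt (hanti (Nat.lt_succ_self n))) hn (hfix n)

namespace Lamination

variable {L L₁ L₂ : Lamination}

/-! ### The stabilizer of a point -/

/-- If `q` is the first point after `p` that is joined to `p` by a leaf, then `p` and `q` are not
consecutive fixed points: leaves close to this leaf would be moved across themselves. -/
lemma not_consecutive_of_rel (hV : L.IsVeryFull) (hL : L.IsLoose) {F : ℝ ≃o ℝ}
    (hF : L.Preserves F) {p q : ℝ} (hqp : q < p + 1) (h : L.Rel p q)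
    (hmin : ∀ v, p < v → v < q → ¬ L.Rel p v) (hpq : Consecutive F p q) : False := by
  wlog hgt : ∀ w, p < w → w < q → w < F w generalizing F
  · refine this hF.symm hpq.symm fun w h1 h2 => ?_
    rw [OrderIso.lt_symm_apply]
    exact (forall_lt_or_forall_gt hpq.2.2.2).resolve_right hgt w h1 h2
  obtain ⟨hlt, -, hq, -⟩ := hpq
  have ltq : ∀ w, w < q → F w < q := fun w hw => by
    have := F.strictMono hw
    rwa [hq] at this
  set y := (p + q) / 2 with hy
  have hFy := ltq y (by linarith)
  have hyF := hgt y (by linarith) (by linarith)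
  have m1 := min_le_left (y - p) (q - F y)
  have m2 := min_le_right (y - p) (q - F y)
  rcases hV.exists_adjacent_leaf hlt hqp h
    (lt_min (by linarith) (by linarith) : 0 < min (y - p) (q - F y)) with
    ⟨v, hv1, hv2, hv⟩ | ⟨s, t, h1, h2, h3, h4, hst, hor⟩
  · exact hmin v hv1 hv2 hv
  rcases eq_or_lt_of_le h1 with rfl | h1
  · exact hmin t (by linarith) (hor.resolve_left (lt_irrefl _)) hst
  have hs := hgt s h1 (by linarith)
  rcases eq_or_lt_of_le h4 with rfl | h4
  -- if the nearby leaf ends at `q`, its images are too many leaves with this endpoint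
  · have hs2 := hgt (F s) (by linarith) (ltq s (by linarith))
    have r0 : L.Rel (t - 1) s := by
      rw [← rel_add_one_left, sub_add_cancel]; exact Rel.symm hst
    have r1 : ∀ w, L.Rel (t - 1) w → L.Rel (t - 1) (F w) := by
      intro w hw
      rw [← rel_add_one_left, sub_add_cancel] at hw ⊢
      conv => arg 2; rw [← hq]
      exact (hF _ _).2 hw
    exact hL.not_three (by linarith) hs hs2 (by linarith [ltq _ (ltq s (by linarith))])
      r0 (r1 _ r0) (r1 _ (r1 _ r0))
  · have hFs : F s < F y := F.strictMono (by linarith)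
    exact Rel.not_link hst ((hF s t).2 hst) hs (by linarith) (hgt t (by linarith) h4)
      (by linarith [ltq t h4])

/-- Two very full, loose laminations without common endpoints. -/
structure IsTransversePair (L₁ L₂ : Lamination) : Prop where
  full₁ : L₁.IsVeryFull
  full₂ : L₂.IsVeryFull
  loose₁ : L₁.IsLoose
  loose₂ : L₂.IsLoose
  disj : ∀ x s t, L₁.Rel x s → ¬ L₂.Rel x t

lemma IsTransversePair.swap (h : IsTransversePair L₁ L₂) : IsTransversePair L₂ L₁ :=
  ⟨h.full₂, h.full₁, h.loose₂, h.loose₁, fun x s t hs ht => h.disj x t s ht hs⟩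

/-- `F` is the lift of an automorphism of both laminations of a pair: it is either the identity or
has countably many fixed points. -/
structure IsPairAut (L₁ L₂ : Lamination) (F : ℝ ≃o ℝ) : Prop where
  pres₁ : L₁.Preserves F
  pres₂ : L₂.Preserves F
  per : ∀ x, F (x + 1) = F x + 1
  countable : F ≠ 1 → {x | F x = x}.Countable

lemma IsPairAut.swap {F : ℝ ≃o ℝ} (h : IsPairAut L₁ L₂ F) : IsPairAut L₂ L₁ F :=
  ⟨h.pres₂, h.pres₁, h.per, h.countable⟩

lemma IsPairAut.rightIsolated (hT : IsTransversePair L₁ L₂) {F : ℝ ≃o ℝ}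
    (hF : IsPairAut L₁ L₂ F) (hF1 : F ≠ 1) {x : ℝ} (hx : F x = x) : RightIsolated F x :=
  rightIsolated_of_fixed hT.full₁ hT.full₂ hT.loose₁ hT.loose₂ hT.disj hF.pres₁ hF.pres₂ hF.per
    (hF.countable hF1) hx

lemma IsPairAut.hasUniqueCrossing (hT : IsTransversePair L₁ L₂) {F : ℝ ≃o ℝ}
    (hF : IsPairAut L₁ L₂ F) (hF1 : F ≠ 1) {p q : ℝ} (hp : F p = p) (hq : F q = q) (hpq : p < q)
    (hqp : q ≤ p + 1) (hnc : ¬ Consecutive F p q) (h₁ : ∀ v, p < v → v < q → ¬ L₁.Rel p v)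
    (h₂ : ∀ v, p < v → v < q → ¬ L₂.Rel p v) : HasUniqueCrossing F p q := by
  obtain ⟨x, hpx, hxq⟩ := (hF.rightIsolated hT hF1 hp).exists_consecutive hpq hq
  have hxq' : x < q := lt_of_le_of_ne hxq (by rintro rfl; exact hnc hpx)
  have hx := hpx.2.2.1
  obtain ⟨z, hxz, hzq⟩ := (hF.rightIsolated hT hF1 hx).exists_consecutive hxq' hq
  have hpx1 := hpx.1
  have hxz1 := hxz.1
  have main : ∀ {M : Lamination}, M.IsVeryFull → M.Preserves F → (∀ t, ¬ M.Rel x t) →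
      (∀ v, p < v → v < q → ¬ M.Rel p v) → HasUniqueCrossing F p q := by
    intro M hM hFM hend hv
    have hz : z = q := by
      by_contra hne
      have hzq' := lt_of_le_of_ne hzq hne
      exact hv z (by linarith) hzq' (hFM.rel_of_consecutive hM hpx hxz (by linarith) hend)
    subst hz
    exact ⟨x, hpx1, hxq', (hFM.opposite_signs hM hpx hxz hend).symm⟩
  by_cases h : ∀ t, ¬ L₁.Rel x t
  · exact main hT.full₁ hF.pres₁ h h₁
  · push Not at h
    obtain ⟨s, hs⟩ := h
    exact main hT.full₂ hF.pres₂ (fun t => hT.disj x s t hs) h₂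

/-- All nontrivial elements of the stabilizer of `p` have a unique crossing in one and the same
interval `(p, q)`. If `p` is an endpoint of a leaf, `q` is the first point joined to `p` by a
leaf; otherwise `q = p + 1`. -/
lemma exists_forall_hasUniqueCrossing (hT : IsTransversePair L₁ L₂) {Γ : Subgroup (ℝ ≃o ℝ)}
    (hΓ : ∀ F ∈ Γ, IsPairAut L₁ L₂ F) {p : ℝ} (hp : ∀ F ∈ Γ, F p = p) :
    ∃ q, (∀ F ∈ Γ, F q = q) ∧ ∀ F ∈ Γ, F ≠ 1 → HasUniqueCrossing F p q := by
  have hp1 : ∀ F ∈ Γ, F (p + 1) = p + 1 := fun F hF => by rw [(hΓ F hF).per, hp F hF]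
  have main : ∀ {L₁ L₂ : Lamination}, IsTransversePair L₁ L₂ → (∀ F ∈ Γ, IsPairAut L₁ L₂ F) →
      ∀ t, L₁.Rel p t → ∃ q, (∀ F ∈ Γ, F q = q) ∧ ∀ F ∈ Γ, F ≠ 1 → HasUniqueCrossing F p q := by
    intro L₁ L₂ hT hΓ t ht
    obtain ⟨t₀, h1, h2, h3⟩ := exists_rep p (t : S1)
    have ht₀ : L₁.Rel p t₀ := by rw [Rel, h3]; exact ht
    have h1' : p < t₀ := lt_of_le_of_ne h1 (by rintro rfl; exact L₁.ne _ _ ht₀ rfl)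
    obtain ⟨q, hpq, hqp, hq, hmin⟩ :
        ∃ q, p < q ∧ q < p + 1 ∧ L₁.Rel p q ∧ ∀ v, p < v → v < q → ¬ L₁.Rel p v := by
      by_contra hcon
      push Not at hcon
      obtain ⟨u, hu1, hu2, hu⟩ := hcon t₀ h1' h2 ht₀
      obtain ⟨v, hv1, hv2, hv⟩ := hcon u hu1 (by linarith) hu
      exact hT.loose₁.not_three hv1 hv2 hu2 h2 hv hu ht₀
    have hle : ∀ F ∈ Γ, q ≤ F q := by
      intro F hF
      by_contra hlt
      push Not at hlt
      refine hmin (F q) ?_ hlt ?_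
      · rw [← hp F hF]; exact F.strictMono hpq
      · conv => arg 2; rw [← hp F hF]
        exact ((hΓ F hF).pres₁ _ _).2 hq
    have hfq : ∀ F ∈ Γ, F q = q := fun F hF =>
      le_antisymm ((OrderIso.le_symm_apply F).1 (hle _ (Γ.inv_mem hF))) (hle F hF)
    refine ⟨q, hfq, fun F hF hF1 => ?_⟩
    refine (hΓ F hF).hasUniqueCrossing hT hF1 (hp F hF) (hfq F hF) hpq hqp.le ?_ hmin
      fun v _ _ => hT.disj p q v hq
    exact not_consecutive_of_rel hT.full₁ hT.loose₁ (hΓ F hF).pres₁ hqp hq hmin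
  by_cases h₁ : ∀ t, ¬ L₁.Rel p t
  · by_cases h₂ : ∀ t, ¬ L₂.Rel p t
    · refine ⟨p + 1, hp1, fun F hF hF1 => ?_⟩
      refine (hΓ F hF).hasUniqueCrossing hT hF1 (hp F hF) (hp1 F hF) (by linarith) le_rfl ?_
        (fun v _ _ => h₁ v) fun v _ _ => h₂ v
      -- a single fixed point would attract on one side and repel on the other
      intro hc
      have hc' : Consecutive F (p + 1) (p + 2) := by
        refine ⟨by linarith, hp1 F hF, ?_, fun w h1 h2 hw => hc.2.2.2 (w - 1) (by linarith)
          (by linarith) ?_⟩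
        · rw [show p + 2 = p + 1 + 1 by ring, (hΓ F hF).per, hp1 F hF]
        · have := (hΓ F hF).per (w - 1)
          rw [sub_add_cancel, hw] at this
          linarith
      have hper := (hΓ F hF).per (p + 1 / 2)
      rcases (hΓ F hF).pres₁.opposite_signs hT.full₁ hc hc'
        (fun t ht => h₁ t (rel_add_one_left.1 ht)) with ⟨a, b⟩ | ⟨a, b⟩
      all_goals
        have a' := a (p + 1 / 2) (by linarith) (by linarith)
        have b' := b (p + 1 / 2 + 1) (by linarith) (by linarith)
        linarith
    · push Not at h₂
      obtain ⟨t, ht⟩ := h₂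
      exact main hT.swap (fun F hF => (hΓ F hF).swap) t ht
  · push Not at h₁
    obtain ⟨t, ht⟩ := h₁
    exact main hT hΓ t ht

/-- All nontrivial elements of the stabilizer of a point have the same fixed points. -/
theorem fixed_iff_fixed (hT : IsTransversePair L₁ L₂) {Γ : Subgroup (ℝ ≃o ℝ)}
    (hΓ : ∀ F ∈ Γ, IsPairAut L₁ L₂ F) {p : ℝ} (hp : ∀ F ∈ Γ, F p = p) {F H : ℝ ≃o ℝ} (hF : F ∈ Γ)
    (hH : H ∈ Γ) (hF1 : F ≠ 1) (hH1 : H ≠ 1) (x : ℝ) : F x = x ↔ H x = x := by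
  obtain ⟨q, hq, hcr⟩ := exists_forall_hasUniqueCrossing hT hΓ hp
  have hcomm := commute_of_hasUniqueCrossing hp hq hcr hF hH
  have hpk : ∀ K ∈ Γ, ∀ k : ℤ, K (p + k) = p + k := fun K hK k => by
    rw [apply_add_int (hΓ K hK).per, hp K hK]
  exact ⟨fixed_of_commute hcomm (hpk H hH) fun y hy => (hΓ F hF).rightIsolated hT hF1 hy,
    fixed_of_commute hcomm.symm (hpk F hF) fun y hy => (hΓ H hH).rightIsolated hT hH1 hy⟩

end Lamination

/-! ### Lifts of homeomorphisms with a fixed point -/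

/-- `F` is the lift of `f` to the line that fixes `p`. -/
structure IsLift (p : ℝ) (f : S1 ≃ₜ S1) (F : ℝ ≃o ℝ) : Prop where
  fixed : F p = p
  per : ∀ x, F (x + 1) = F x + 1
  coe : ∀ x : ℝ, (F x : S1) = f x

lemma IsLift.mul {p : ℝ} {f h : S1 ≃ₜ S1} {F H : ℝ ≃o ℝ} (hF : IsLift p f F) (hH : IsLift p h H) :
    IsLift p (f * h) (F * H) := by
  refine ⟨?_, fun x => ?_, fun x => ?_⟩
  · change F (H p) = p
    rw [hH.fixed, hF.fixed]
  · change F (H (x + 1)) = F (H x) + 1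
    rw [hH.per, hF.per]
  · change (F (H x) : S1) = f (h x)
    rw [hF.coe, hH.coe]

lemma IsLift.inv {p : ℝ} {f : S1 ≃ₜ S1} {F : ℝ ≃o ℝ} (hF : IsLift p f F) :
    IsLift p f⁻¹ F⁻¹ := by
  refine ⟨symm_fixed hF.fixed, fun x => ?_, fun x => ?_⟩
  · change F.symm (x + 1) = F.symm x + 1
    rw [OrderIso.symm_apply_eq, hF.per, F.apply_symm_apply]
  · change (F.symm x : S1) = f.symm x
    rw [← f.symm_apply_apply ((F.symm x : ℝ) : S1), ← hF.coe, F.apply_symm_apply]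

/-- Both `x` and its image lie in the same interval between consecutive integer translates of
the fixed point. -/
lemma IsLift.mem_window {p : ℝ} {f : S1 ≃ₜ S1} {F : ℝ ≃o ℝ} (hF : IsLift p f F) (x : ℝ) :
    F x < x + 1 ∧ x < F x + 1 := by
  have h1 := Int.floor_le (x - p)
  have h2 := Int.lt_floor_add_one (x - p)
  have hfix : ∀ k : ℤ, F (p + k) = p + k := fun k => by
    rw [Lamination.apply_add_int hF.per, hF.fixed]
  have h3 : F (p + ⌊x - p⌋) ≤ F x := F.monotone (by linarith)
  have h4 : F x < F (p + (⌊x - p⌋ + 1 : ℤ)) := F.strictMono (by push_cast; linarith)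
  rw [hfix] at h3 h4
  push_cast at h4
  constructor <;> linarith

lemma IsLift.apply_eq_iff {p : ℝ} {f : S1 ≃ₜ S1} {F : ℝ ≃o ℝ} (hF : IsLift p f F) (x : ℝ) :
    F x = x ↔ f x = x := by
  rw [← hF.coe]
  exact ⟨fun h => by rw [h], coe_inj_of_near (hF.mem_window x).1 (hF.mem_window x).2⟩

lemma IsLift.eq_one_iff {p : ℝ} {f : S1 ≃ₜ S1} {F : ℝ ≃o ℝ} (hF : IsLift p f F) :
    F = 1 ↔ f = 1 := by
  constructor
  · rintro rfl
    ext x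
    obtain ⟨t, -, -, rfl⟩ := exists_rep 0 x
    exact (hF.apply_eq_iff t).1 rfl
  · rintro rfl
    ext x
    exact (hF.apply_eq_iff x).2 rfl

lemma exists_isLift {f : S1 ≃ₜ S1} (hf : f ∈ HomeoPlus) {p : ℝ} (hp : f p = p) :
    ∃ F, IsLift p f F := by
  choose a ha1 ha2 ha3 using exists_rep p
  have huniq : ∀ t, p ≤ t → t < p + 1 → a t = t := fun t h1 h2 =>
    coe_inj_of_near (by linarith [ha2 t]) (by linarith [ha1 t]) (ha3 t)
  have hint : ∀ (x : ℝ) (k : ℤ), ((x + k : ℝ) : S1) = x := by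
    intro x k
    rw [AddCircle.coe_add]
    have : ((k : ℝ) : S1) = 0 := (AddCircle.coe_eq_zero_iff 1).2 ⟨k, by simp⟩
    rw [this, add_zero]
  have hfl : ∀ (x : ℝ) (k : ℤ), p ≤ x → x < p + 1 → ⌊x + k - p⌋ = k := by
    intro x k h1 h2
    rw [Int.floor_eq_iff]
    constructor <;> linarith
  have hdec : ∀ x : ℝ, ∃ x' : ℝ, ∃ k : ℤ, p ≤ x' ∧ x' < p + 1 ∧ x = x' + k := fun x =>
    ⟨x - ⌊x - p⌋, ⌊x - p⌋, by linarith [Int.floor_le (x - p)],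
      by linarith [Int.lt_floor_add_one (x - p)], by ring⟩
  set F : ℝ → ℝ := fun x => a (f x) + ⌊x - p⌋ with hFdef
  have hF : ∀ (x : ℝ) (k : ℤ), p ≤ x → x < p + 1 → F (x + k) = a (f x) + k := by
    intro x k h1 h2
    simp only [hFdef]
    rw [hfl x k h1 h2, hint]
  have hmono' : ∀ x y, p ≤ x → x < y → y < p + 1 → a (f x) < a (f y) := by
    intro x y h1 h2 h3
    rcases eq_or_lt_of_le h1 with rfl | h1
    · rw [hp, huniq p le_rfl (by linarith)]
      refine lt_of_le_of_ne (ha1 _) fun e => ?_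
      have h4 : (p : S1) = f y := by
        conv_lhs => rw [e]
        exact ha3 _
      rw [← hp] at h4
      exact h2.ne (coe_inj_of_near (by linarith) h3 (f.injective h4))
    · have hs := (hf p x y).2 (sbtw_coe h1 h2 h3)
      rw [hp, ← ha3 (f x), ← ha3 (f y)] at hs
      exact ((sbtw_coe_iff (ha1 _) (ha2 _) (ha1 _) (ha2 _)).1 hs).2
  have hmono : StrictMono F := by
    intro x y hxy
    obtain ⟨x, k, hx1, hx2, rfl⟩ := hdec x
    obtain ⟨y, l, hy1, hy2, rfl⟩ := hdec y
    rw [hF x k hx1 hx2, hF y l hy1 hy2]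
    have hkl : k < l + 1 := by
      have : (k : ℝ) < l + 1 := by linarith
      exact_mod_cast this
    rcases eq_or_lt_of_le (Int.lt_add_one_iff.1 hkl) with rfl | hkl
    · linarith [hmono' x y hx1 (by linarith) hy2]
    · have : (k : ℝ) + 1 ≤ l := by exact_mod_cast hkl
      linarith [ha2 (f x), ha1 (f y)]
  have hsurj : Function.Surjective F := by
    intro y
    obtain ⟨y, l, hy1, hy2, rfl⟩ := hdec y
    refine ⟨a (f.symm y) + l, ?_⟩
    rw [hF _ l (ha1 _) (ha2 _), ha3, f.apply_symm_apply, huniq y hy1 hy2]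
  refine ⟨hmono.orderIsoOfSurjective F hsurj, ?_, fun x => ?_, fun x => ?_⟩
  · change a (f p) + ⌊p - p⌋ = p
    rw [hp, huniq p le_rfl (by linarith)]
    simp
  · change a (f (x + 1 : ℝ)) + ⌊x + 1 - p⌋ = a (f x) + ⌊x - p⌋ + 1
    rw [coe_add_one, show x + 1 - p = x - p + 1 by ring, Int.floor_add_one]
    push_cast
    ring
  · change ((a (f x) + ⌊x - p⌋ : ℝ) : S1) = f x
    rw [hint, ha3]

/-- The lifts fixing `p` of the elements of `G` that fix the image of `p`. -/
def stabilizerLift (G : Subgroup (S1 ≃ₜ S1)) (p : ℝ) : Subgroup (ℝ ≃o ℝ) where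
  carrier := {F | ∃ f ∈ G, IsLift p f F}
  one_mem' := ⟨1, G.one_mem, rfl, fun _ => rfl, fun _ => rfl⟩
  mul_mem' := by
    rintro F H ⟨f, hf, hF⟩ ⟨h, hh, hH⟩
    exact ⟨f * h, G.mul_mem hf hh, hF.mul hH⟩
  inv_mem' := by
    rintro F ⟨f, hf, hF⟩
    exact ⟨f⁻¹, G.inv_mem hf, hF.inv⟩

lemma countable_preimage_coe {s : Set S1} (hs : s.Countable) :
    (((↑) : ℝ → S1) ⁻¹' s).Countable := by
  have : ((↑) : ℝ → S1) ⁻¹' s ⊆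
      ⋃ n : ℤ, {x : ℝ | x ∈ Ico (n : ℝ) (n + 1) ∧ (x : S1) ∈ s} := fun x hx =>
    mem_iUnion.2 ⟨⌊x⌋, ⟨Int.floor_le x, Int.lt_floor_add_one x⟩, hx⟩
  refine (countable_iUnion fun n => ?_).mono this
  refine MapsTo.countable_of_injOn (f := ((↑) : ℝ → S1)) (fun x hx => hx.2) ?_ hs
  intro x hx y hy hxy
  exact coe_inj_of_near (by linarith [hx.1.2, hy.1.1]) (by linarith [hx.1.1, hy.1.2]) hxy

lemma IsLift.isPairAut {L₁ L₂ : Lamination} {G : Subgroup (S1 ≃ₜ S1)} (h₁ : L₁.IsInvariant G)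
    (h₂ : L₂.IsInvariant G) (hfix : ∀ g ∈ G, g ≠ 1 → (Fix g).Countable) {p : ℝ} {f : S1 ≃ₜ S1}
    (hf : f ∈ G) {F : ℝ ≃o ℝ} (hF : IsLift p f F) : Lamination.IsPairAut L₁ L₂ F where
  pres₁ s t := by
    rw [Lamination.Rel, hF.coe, hF.coe]
    exact h₁ f hf _ _
  pres₂ s t := by
    rw [Lamination.Rel, hF.coe, hF.coe]
    exact h₂ f hf _ _
  per := hF.per
  countable hF1 := (countable_preimage_coe (hfix f hf (mt hF.eq_one_iff.2 hF1))).mono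
    fun x hx => (hF.apply_eq_iff x).1 hx

/-! ### Periodic points -/

lemma zpow_mul_apply_of_fixed {f : S1 ≃ₜ S1} {n : ℕ} {x : S1} (h : (f ^ n) x = x) (k : ℤ) :
    (f ^ ((n : ℤ) * k)) x = x := by
  let S : Subgroup (S1 ≃ₜ S1) :=
    { carrier := {g | g x = x}
      one_mem' := rfl
      mul_mem' := fun {a b} (ha : a x = x) (hb : b x = x) => show a (b x) = x by rw [hb, ha]
      inv_mem' := fun {a} (ha : a x = x) => show a.symm x = x by
        conv_lhs => rw [← ha, a.symm_apply_apply] }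
  rw [zpow_mul, zpow_natCast]
  exact S.zpow_mem h k

lemma mem_Per_iff {f : S1 ≃ₜ S1} {x : S1} : x ∈ Per f ↔ ∃ n : ℕ, 0 < n ∧ (f ^ n) x = x := by
  constructor
  · intro hx
    have hni : ¬ Function.Injective fun n : ℕ => (f ^ n) x := fun hinj => by
      refine Set.infinite_range_of_injective hinj (hx.subset ?_)
      rintro _ ⟨n, rfl⟩
      exact ⟨n, by simp only [zpow_natCast]⟩
    have hlt : ∀ i j : ℕ, i < j → (f ^ i) x = (f ^ j) x → ∃ n : ℕ, 0 < n ∧ (f ^ n) x = x := by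
      intro i j hij h
      refine ⟨j - i, by omega, (f ^ i).injective ?_⟩
      change (f ^ i * f ^ (j - i)) x = (f ^ i) x
      rw [← pow_add, h]
      congr 2
      omega
    rw [Function.Injective] at hni
    push Not at hni
    obtain ⟨i, j, hij, hne⟩ := hni
    rcases lt_or_gt_of_ne hne with h | h
    · exact hlt i j h hij
    · exact hlt j i h hij.symm
  · rintro ⟨n, hn, hx⟩
    refine ((Finset.range n).finite_toSet.image fun k => (f ^ k) x).subset ?_
    rintro _ ⟨k, rfl⟩
    have hn' : (0 : ℤ) < n := by exact_mod_cast hn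
    obtain ⟨r, hr⟩ := Int.eq_ofNat_of_zero_le (Int.emod_nonneg k hn'.ne')
    refine ⟨r, ?_, ?_⟩
    · have := Int.emod_lt_of_pos k hn'
      simp only [Finset.coe_range, mem_Iio]
      omega
    · change (f ^ r) x = (f ^ k) x
      rw [← Int.emod_add_mul_ediv k n, hr, zpow_add]
      change _ = (f ^ ((r : ℕ) : ℤ)) ((f ^ _) x)
      rw [zpow_mul_apply_of_fixed hx, zpow_natCast]

/-- An orientation-preserving homeomorphism with a fixed point has no other periodic points. -/
lemma mem_Per_iff_of_isLift {f : S1 ≃ₜ S1} {n : ℕ} (hn : 0 < n) {p : ℝ} {F : ℝ ≃o ℝ}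
    (hF : IsLift p (f ^ n) F) (x : ℝ) : (x : S1) ∈ Per f ↔ F x = x := by
  rw [mem_Per_iff]
  constructor
  · rintro ⟨d, hd, hx⟩
    have hFd : ∀ k : ℕ, IsLift p ((f ^ n) ^ k) (F ^ k) := by
      intro k
      induction k with
      | zero => exact ⟨rfl, fun _ => rfl, fun _ => rfl⟩
      | succ k ih => rw [pow_succ, pow_succ]; exact ih.mul hF
    have h1 : F^[d] x = x := by
      rw [← pow_apply, (hFd d).apply_eq_iff, ← pow_mul, mul_comm]
      have := zpow_mul_apply_of_fixed hx n
      rwa [← Nat.cast_mul, zpow_natCast] at this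
    by_contra hne
    rcases lt_or_gt_of_ne hne with h | h
    · have := F.strictMono.strictAnti_iterate_of_map_lt h hd
      simp only [Function.iterate_zero, id, h1] at this
      exact lt_irrefl _ this
    · have := F.strictMono.strictMono_iterate_of_lt_map h hd
      simp only [Function.iterate_zero, id, h1] at this
      exact lt_irrefl _ this
  · intro h
    exact ⟨n, hn, (hF.apply_eq_iff x).1 h⟩

end CircleLamination

theorem theoremB (G : Subgroup (CircleLamination.S1 ≃ₜ CircleLamination.S1))
    (hG : CircleLamination.IsPseudoFibered G) (htf : CircleLamination.IsTorsionFreeGroup G)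
    (g h : CircleLamination.S1 ≃ₜ CircleLamination.S1) (hg : g ∈ G) (hh : h ∈ G)
    (hg1 : g ≠ 1) (hh1 : h ≠ 1) :
    CircleLamination.Per g = CircleLamination.Per h ∨
      Disjoint (CircleLamination.Per g) (CircleLamination.Per h) := by
  open CircleLamination in
  obtain ⟨-, ⟨hGH, -, -⟩, ⟨L₁, L₂, hV₁, hL₁, hI₁, hV₂, hL₂, hI₂, hdisj⟩, hfix⟩ := hG
  refine or_iff_not_imp_right.2 fun hnd => ?_
  obtain ⟨x₀, hx₀g, hx₀h⟩ := Set.not_disjoint_iff.1 hnd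
  obtain ⟨p, -, -, rfl⟩ := exists_rep 0 x₀
  obtain ⟨m, hm, hgm⟩ := mem_Per_iff.1 hx₀g
  obtain ⟨n, hn, hhn⟩ := mem_Per_iff.1 hx₀h
  obtain ⟨F, hF⟩ := exists_isLift (hGH (G.pow_mem hg m)) hgm
  obtain ⟨H, hH⟩ := exists_isLift (hGH (G.pow_mem hh n)) hhn
  have hF1 : F ≠ 1 := fun e =>
    htf g hg hg1 (isOfFinOrder_iff_pow_eq_one.2 ⟨m, hm, hF.eq_one_iff.1 e⟩)
  have hH1 : H ≠ 1 := fun e =>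
    htf h hh hh1 (isOfFinOrder_iff_pow_eq_one.2 ⟨n, hn, hH.eq_one_iff.1 e⟩)
  have hT : Lamination.IsTransversePair L₁ L₂ := ⟨hV₁, hV₂, hL₁, hL₂, fun x s t hs ht =>
    Set.disjoint_left.1 hdisj ⟨_, hs⟩ ⟨_, ht⟩⟩
  have key := Lamination.fixed_iff_fixed hT (Γ := stabilizerLift G p) (p := p)
    (by rintro K ⟨f, hf, hK⟩; exact hK.isPairAut hI₁ hI₂ hfix hf)
    (by rintro K ⟨f, hf, hK⟩; exact hK.fixed)
    ⟨_, G.pow_mem hg m, hF⟩ ⟨_, G.pow_mem hh n, hH⟩ hF1 hH1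
  ext x
  obtain ⟨t, -, -, rfl⟩ := exists_rep 0 x
  rw [mem_Per_iff_of_isLift hm hF, mem_Per_iff_of_isLift hn hH, key]
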